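/- **Setting.** Let $f\in C^2(\mathbb R)$ with $f''\ge 0$ and $\mathcal L\{u: f''(u)=0\}=0$, and let $\varphi\in L^\infty(\mathbb R)$. For $x\in\mathbb R$, $t>0$ put $$E(u;x,t)=t\int_0^u f''(s)\big(\varphi(x-tf'(s))-s\big)\,ds,\qquad \mathcal U(x,t)=\Big\{w: E(w;x,t)=\max_{v\in\mathbb R}E(v;x,t)\Big\},\qquad u(x,t)=\inf\mathcal U(x,t);$$ $u$ is the (pointwise defined) entropy solution of $u_t+f(u)_x=0$, $u|_{t=0}=\varphi$. Let $L_c(x_0)=\{(x_0+tf'(c),t): t>0\}$ and $\mathcal C(x_0)=\{c: c\in\mathcal U(x,t)\text{ for some }(x,t)\in L_c(x_0)\}$; for $c\in\mathcal C(x_0)$ the line $L_c(x_0)$ is called a characteristic emitting from $x_0$. For $\tau>0$, $\mathcal C_\tau(x)$ is defined as $\mathcal C(x)$ with the initial data $\varphi$ replaced by $u(\cdot,\tau)$ (time counted from $\tau$). A point $(x,t)$ with $t>0$ is a *continuous shock generation point* if $u(x-,t)=u(x+,t)$ and $\mathcal C_t(x)=\varnothing$ (no characteristic starts at $(x,t)$,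 so the wave emitted there is a shock). Let $\Phi(x)=\int_0^x\varphi$, let $\overline D_-\Phi(x_0)=\limsup_{l\to0-}\frac{\Phi(x_0+l)-\Phi(x_0)}l$ and $\underline D_+\Phi(x_0)=\liminf_{l\to0+}\frac{\Phi(x_0+l)-\Phi(x_0)}l$, and put $$\Phi(l;x_0,c)=\int_{x_0}^{x_0+l}(\varphi(\xi)-c)\,d\xi,\qquad F(l;t,c)=-t\int_c^{(f')^{-1}(f'(c)-l/t)}(s-c)f''(s)\,ds .$$ For $c\in\mathcal C(x_0)$ define in $(0,\infty]$ $$t_p^\pm=\sup\{t>0:\Phi(l;x_0,c)>F(l;t,c)\text{ for small }\pm l>0\},\qquad t_p=\min\{t_p^+,t_p^-\},$$ $$t_*=\sup\{t>0: c\in\mathcal U(x_0+tf'(c),t)\},$$ and, if $t_p<\infty$, $x_p=x_0+t_pf'(c)$. ($t_*$ is the lifespan of $L_c(x_0)$ and $t_p$ an upper bound of it.) Let $\rho(u,v)=\int_v^u sf''(s)\,ds\big/\int_v^u f''(s)\,ds$ for $u\ne v$ and $\rho(v,v)=v$. **Theorem 4.1 (formation of shocks at continuous shock generation points).** (A) Every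 continuous shock generation point $(x,t)$ is the point $(x_p,t_p)$, with $t_*=t_p=t$, of some characteristic $L_c(x_0)$, $c\in\mathcal C(x_0)$. (B) Let $c\in\mathcal C(x_0)$. Then $t_p\in(0,\infty)$, $L_c(x_0)$ lives up to time $t_p$ (that is, $t_*=t_p$) and $(x_p,t_p)$ is a continuous shock generation point, if and only if $t_p\in(0,\infty)$ and $$\Phi(x_0+l)-\Phi(x_0)-cl>\Big(\rho\big((f')^{-1}(f'(c)-l/t_p),c\big)-c\Big)\,l$$ for all $l\ne0$ of the form $l=t_p(f'(c)-f'(u))$, $u\in\mathbb R$. (C) Let $c\in\mathcal C(x_0)$, and consider the power laws $$f''(u)=(N_\pm+o(1))|u-c|^{\alpha_\pm}\ (u\to c\pm),\qquad \varphi(x_0+l)-c=(C_{\gamma_\pm}+o(1))\,\mathrm{sgn}(l)\,|l|^{\gamma_\pm}\ (l\to0\pm,\ \text{a.e. } l)$$ with constants $\alpha_\pm\ge0$, $\gamma_\pm>0$, $N_\pm>0$, $C_{\gamma_\pm}\ne0$. (i) Let $\overline D_-\Phi(x_0)<\underline D_+\Phi(x_0)$. If $t_p\in(0,\infty)$, then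 $c=\overline D_-\Phi(x_0)$ or $c=\underline D_+\Phi(x_0)$. Moreover: (a) If $c=\overline D_-\Phi(x_0)$ and the power laws for $u\to c+$ and $l\to0-$ hold, then $t_p\in(0,\infty)$ if and only if $C_{\gamma_-}<0$ and $\gamma_-(1+\alpha_+)=1$; in that case $t_p=t_p^-=(\gamma_-N_+|C_{\gamma_-}|^{1+\alpha_+})^{-1}$. (b) If $c=\underline D_+\Phi(x_0)$ and the power laws for $u\to c-$ and $l\to0+$ hold, then $t_p\in(0,\infty)$ if and only if $C_{\gamma_+}<0$ and $\gamma_+(1+\alpha_-)=1$; in that case $t_p=t_p^+=(\gamma_+N_-|C_{\gamma_+}|^{1+\alpha_-})^{-1}$. (ii) Let $\overline D_-\Phi(x_0)=\underline D_+\Phi(x_0)$ and let all four power laws hold. Then, for each choice of sign, $t_p^\pm\in(0,\infty)$ if and only if $C_{\gamma_\pm}<0$ and $\gamma_\pm(1+\alpha_\mp)=1$; in that case $t_p^\pm=(\gamma_\pm N_\mp|C_{\gamma_\pm}|^{1+\alpha_\mp})^{-1}$. If $t_p\in(0,\infty)$, then exactly one of three cases occurs: $t_p^-\in(0,\infty)$,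 $t_p^+=\infty$ and $t_p=(\gamma_-N_+|C_{\gamma_-}|^{1+\alpha_+})^{-1}$; or $t_p^+\in(0,\infty)$, $t_p^-=\infty$ and $t_p=(\gamma_+N_-|C_{\gamma_+}|^{1+\alpha_-})^{-1}$; or $t_p^+,t_p^-\in(0,\infty)$ and $t_p$ is the minimum of these two numbers. -/

import Mathlib

open Set Filter Topology MeasureTheory

noncomputable section

namespace ConsLaw

/-- Admissible fluxes: `f ∈ C²(ℝ)`, `f'' ≥ 0`, and the zero set of `f''` is Lebesgue-null. -/
structure IsFlux (f : ℝ → ℝ) : Prop where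
  contDiff : ContDiff ℝ 2 f
  nonneg : ∀ u, 0 ≤ deriv (deriv f) u
  null : volume {u : ℝ | deriv (deriv f) u = 0} = 0

/-- `E(u;x,t) = t ∫₀ᵘ f''(s) (φ(x - t f'(s)) - s) ds`. -/
def E (f φ : ℝ → ℝ) (u x t : ℝ) : ℝ :=
  t * ∫ s in (0 : ℝ)..u, deriv (deriv f) s * (φ (x - t * deriv f s) - s)

/-- The set `𝒰(x,t)` of global maximum points of `E(·;x,t)`. -/
def maxSet (f φ : ℝ → ℝ) (x t : ℝ) : Set ℝ :=
  {w | ∀ v, E f φ v x t ≤ E f φ w x t}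

/-- The entropy solution of `u_t + f(u)_x = 0`, `u(·,0) = φ`, given at every point with `t > 0`
by the solution formula `u(x,t) = inf 𝒰(x,t)`. -/
def sol (f φ : ℝ → ℝ) (x t : ℝ) : ℝ := sInf (maxSet f φ x t)

/-- The set `𝒞(x₀)` of characteristic generation values: those `c` such that `c ∈ 𝒰(x,t)` for some
point `(x,t)`, `t > 0`, of the line `L_c(x₀) : x = x₀ + t f'(c)`.  For `c ∈ 𝒞(x₀)` the line
`L_c(x₀)` is called a characteristic emitting from `x₀`. -/
def charValues (f φ : ℝ → ℝ) (x₀ : ℝ) : Set ℝ :=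
  {c | ∃ t, 0 < t ∧ c ∈ maxSet f φ (x₀ + t * deriv f c) t}

/-- The set `𝒞_τ(x)`: the characteristic generation values of `x` for the Cauchy problem restarted
at time `τ` with the initial data `u(·,τ)` (time being counted from `τ`). -/
def charValuesAt (f φ : ℝ → ℝ) (τ x : ℝ) : Set ℝ :=
  charValues f (fun ξ => sol f φ ξ τ) x

/-- `(x,t)`, `t > 0`, is a continuous shock generation point: the traces `u(x-,t)` and `u(x+,t)`
agree and no characteristic of the problem restarted at time `t` emits from `x`, so that
the wave emitting from `(x,t)` is a shock. -/
def IsContShockGenPoint (f φ : ℝ → ℝ) (x t : ℝ) : Prop :=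
  0 < t ∧
  (∃ a : ℝ, Tendsto (fun ξ => sol f φ ξ t) (𝓝[<] x) (𝓝 a) ∧
    Tendsto (fun ξ => sol f φ ξ t) (𝓝[>] x) (𝓝 a)) ∧
  charValuesAt f φ t x = ∅

/-- `Φ(x) = ∫₀ˣ φ`. -/
def Phi (φ : ℝ → ℝ) (x : ℝ) : ℝ := ∫ ξ in (0 : ℝ)..x, φ ξ

/-- The upper left Dini derivative of `Φ` at `x₀` (the difference quotients are bounded
for `φ ∈ L^∞`). -/
def upperLeftDini (φ : ℝ → ℝ) (x₀ : ℝ) : ℝ :=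
  limsup (fun l : ℝ => (Phi φ (x₀ + l) - Phi φ x₀) / l) (𝓝[<] 0)

/-- The lower right Dini derivative of `Φ` at `x₀`. -/
def lowerRightDini (φ : ℝ → ℝ) (x₀ : ℝ) : ℝ :=
  liminf (fun l : ℝ => (Phi φ (x₀ + l) - Phi φ x₀) / l) (𝓝[>] 0)

/-- `(f')⁻¹`; for an admissible flux `f'` is injective, and this is its inverse on its range. -/
def derivInv (f : ℝ → ℝ) : ℝ → ℝ := Function.invFun (deriv f)

/-- `Φ(l;x₀,c) = ∫_{x₀}^{x₀+l} (φ(ξ) - c) dξ`. -/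
def PhiLoc (φ : ℝ → ℝ) (x₀ c l : ℝ) : ℝ := ∫ ξ in x₀..(x₀ + l), (φ ξ - c)

/-- `F(l;t,c) = -t ∫_c^{u(l;t,c)} (s - c) f''(s) ds` with `u(l;t,c) = (f')⁻¹(f'(c) - l/t)`. -/
def F (f : ℝ → ℝ) (t c l : ℝ) : ℝ :=
  -t * ∫ s in c..(derivInv f (deriv f c - l / t)), (s - c) * deriv (deriv f) s

/-- `t_p^+(x₀,c) = sup {t > 0 : Φ(l;x₀,c) > F(l;t,c) for small l > 0}`. -/
def tpPlus (f φ : ℝ → ℝ) (x₀ c : ℝ) : EReal :=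
  sSup ((fun t : ℝ => (t : EReal)) ''
    {t : ℝ | 0 < t ∧ ∀ᶠ l in 𝓝[>] (0 : ℝ), F f t c l < PhiLoc φ x₀ c l})

/-- `t_p^-(x₀,c) = sup {t > 0 : Φ(l;x₀,c) > F(l;t,c) for small l < 0}`. -/
def tpMinus (f φ : ℝ → ℝ) (x₀ c : ℝ) : EReal :=
  sSup ((fun t : ℝ => (t : EReal)) ''
    {t : ℝ | 0 < t ∧ ∀ᶠ l in 𝓝[<] (0 : ℝ), F f t c l < PhiLoc φ x₀ c l})

/-- The upper bound `t_p = min {t_p^+, t_p^-}` of the lifespan of `L_c(x₀)`. -/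
def tp (f φ : ℝ → ℝ) (x₀ c : ℝ) : EReal := min (tpPlus f φ x₀ c) (tpMinus f φ x₀ c)

/-- The lifespan `t_* = sup {t > 0 : c ∈ 𝒰(x₀ + t f'(c), t)}` of `L_c(x₀)`. -/
def tStar (f φ : ℝ → ℝ) (x₀ c : ℝ) : EReal :=
  sSup ((fun t : ℝ => (t : EReal)) ''
    {t : ℝ | 0 < t ∧ c ∈ maxSet f φ (x₀ + t * deriv f c) t})

/-- `ρ(u,v) = ∫_v^u s f''(s) ds / ∫_v^u f''(s) ds` if `u ≠ v`, and `ρ(v,v) = v`. -/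
def rho (f : ℝ → ℝ) (u v : ℝ) : ℝ :=
  if u = v then v
  else (∫ s in v..u, s * deriv (deriv f) s) / (∫ s in v..u, deriv (deriv f) s)

/-- The strict inequality
`Φ(x₀+l) - Φ(x₀) - c l > (ρ((f')⁻¹(f'(c) - l/T), c) - c) l`
for all `l ≠ 0` of the form `l = T (f'(c) - f'(u))`, `u ∈ ℝ`. -/
def StrictIneq (f φ : ℝ → ℝ) (x₀ c T : ℝ) : Prop :=
  ∀ l : ℝ, l ≠ 0 → (∃ u : ℝ, l = T * (deriv f c - deriv f u)) →
    (rho f (derivInv f (deriv f c - l / T)) c - c) * l < Phi φ (x₀ + l) - Phi φ x₀ - c * l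

/-- `f''(u) = (N + o(1)) |u - c|^α` as `u → c` within `S`, with `α ≥ 0` and `N > 0`. -/
def FluxPowerLaw (f : ℝ → ℝ) (c : ℝ) (S : Set ℝ) (α N : ℝ) : Prop :=
  0 ≤ α ∧ 0 < N ∧
    Tendsto (fun u : ℝ => deriv (deriv f) u / |u - c| ^ α) (𝓝[S] c) (𝓝 N)

/-- `φ(x₀ + l) - c = (C + o(1)) sgn(l) |l|^γ` as `l → 0` within `S`, with `γ > 0` and `C ≠ 0`.
As `φ ∈ L^∞` is determined up to null sets, this is required for almost every `l` only. -/
def DataPowerLaw (φ : ℝ → ℝ) (x₀ c : ℝ) (S : Set ℝ) (γ C : ℝ) : Prop :=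
  0 < γ ∧ C ≠ 0 ∧
    Tendsto (fun l : ℝ => (φ (x₀ + l) - c) / (Real.sign l * |l| ^ γ))
      (𝓝[S] 0 ⊓ ae volume) (𝓝 C)

/-- The time `(γ N |C|^{1+α})⁻¹`. -/
def focusTime (γ N C α : ℝ) : ℝ := (γ * N * |C| ^ (1 + α))⁻¹

end ConsLaw

end

open ConsLaw

/-!
The integral defining `E` is computed by the substitution `ξ = x - t f'(s)`: up to a term independent
of `u`, `-E(u;x,t)` is the Hopf-Lax functional `Φ(x - t f'(u)) + t f*(f'(u))`, where
`f*(f'(u)) = u f'(u) - f(u)` is the Legendre transform of `f` (`E_eq`). So `𝒰(x,t)` is the set of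
minimum points of that functional, and everything rests on the strict convexity of `f*`, in the form
of the positivity of `excess`.

On the line `L_c(x₀)` the functional at `u` exceeds its value at `c` by `defect`, which is
`Φ(l;x₀,c) - F(l;t,c)` with `l = t (f'(c) - f'(u))`. Hence `c` is a maximum point at time `t` iff all
defects are nonnegative, it is the only one iff the strict inequality of the criterion holds, and
`t_p^±` asks for positive defects for `u` near `c` on one side. Defects decrease along the line
(`exists_defect_lt`), which gives `t_* ≤ t_p`.

The value function `min_u` of the functional has the entropy solution as its right derivative
(`hasDerivWithinAt_value`), so it serves as `Φ` for the restarted problem. Two consequences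
describe continuous shock generation points:
* equal traces at `(x,t)` mean that `𝒰(x,t)` is a singleton `{c}`
  (`maxSet_eq_singleton_of_traces`, `traces_of_maxSet_eq_singleton`);
* by Jensen's inequality for `f*`, a characteristic of the restarted problem emits from a point of
  `L_c(x₀)` at which `L_c(x₀)` is alive iff `L_c(x₀)` lives on beyond that point
  (`mem_maxSet_restart`, `mem_maxSet_of_restart`).

So no characteristic starts at `(x,t)` iff `t_* = t`. If moreover `𝒰(x,t) = {c}`, then `t_p = t`: maximum
points at slightly later times are close to `c`, where competitors lose as long as `t < t_p`
(`tp_eq_of_tStar_eq`).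

For the power laws, put `u = c - σ w` with `σ = ±1` and `w → 0+`. The two parts of the defect are then
asymptotic to multiples of `w ^ ((1+α)(1+γ))` and `w ^ (2+α)` (`tendsto_defect_parts`); the exponents
agree iff `γ (1+α) = 1`, and then the leading coefficient of the defect changes sign at the focusing
time (`leading_coeff_eq`).
-/

noncomputable section

namespace ConsLaw

/-! ### The flux and its Legendre transform -/

theorem IsFlux.contDiff_deriv {f : ℝ → ℝ} (hf : IsFlux f) : ContDiff ℝ 1 (deriv f) :=
  ((contDiff_succ_iff_deriv (n := 1)).1 (by rw [one_add_one_eq_two]; exact hf.contDiff)).2.2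

theorem IsFlux.hasDerivAt {f : ℝ → ℝ} (hf : IsFlux f) (u : ℝ) : HasDerivAt f (deriv f u) u :=
  ((hf.contDiff.differentiable (by norm_num)) u).hasDerivAt

theorem IsFlux.hasDerivAt_deriv {f : ℝ → ℝ} (hf : IsFlux f) (u : ℝ) :
    HasDerivAt (deriv f) (deriv (deriv f) u) u :=
  ((hf.contDiff_deriv.differentiable (by norm_num)) u).hasDerivAt

theorem IsFlux.continuous_deriv {f : ℝ → ℝ} (hf : IsFlux f) : Continuous (deriv f) :=
  hf.contDiff_deriv.continuous

theorem IsFlux.continuous_deriv₂ {f : ℝ → ℝ} (hf : IsFlux f) : Continuous (deriv (deriv f)) :=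
  hf.contDiff_deriv.continuous_deriv (by norm_num)

/-- If `f'` took the same value twice, `f''` would vanish on an interval. -/
theorem IsFlux.strictMono {f : ℝ → ℝ} (hf : IsFlux f) : StrictMono (deriv f) := by
  have hmono : Monotone (deriv f) :=
    monotone_of_deriv_nonneg (fun u => (hf.hasDerivAt_deriv u).differentiableAt) hf.nonneg
  refine hmono.strictMono_of_injective fun u v huv => ?_
  by_contra hne
  wlog h : u < v generalizing u v
  · exact this v u huv.symm (Ne.symm hne) (lt_of_le_of_ne (not_lt.1 h) (Ne.symm hne))
  have hsub : Ioo u v ⊆ {w | deriv (deriv f) w = 0} := by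
    intro w hw
    have : deriv f =ᶠ[𝓝 w] fun _ => deriv f u := by
      filter_upwards [Ioo_mem_nhds hw.1 hw.2] with z hz
      exact le_antisymm (huv ▸ hmono hz.2.le) (hmono hz.1.le)
    simpa using this.deriv_eq
  have h0 := measure_mono_null hsub hf.null
  simp at h0
  linarith

/-- Every value between two values of `f'` is attained, between the corresponding arguments. -/
theorem IsFlux.exists_deriv_eq {f : ℝ → ℝ} (hf : IsFlux f) {u v p : ℝ}
    (hu : deriv f u ≤ p) (hv : p ≤ deriv f v) : ∃ w, deriv f w = p :=
  mem_range_of_exists_le_of_exists_ge hf.continuous_deriv ⟨u, hu⟩ ⟨v, hv⟩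

/-- `(f')⁻¹` is continuous along any convergent family in the range of `f'`. -/
theorem IsFlux.tendsto_of_tendsto_deriv {f : ℝ → ℝ} (hf : IsFlux f) {ι : Type*} {l : Filter ι}
    {g : ι → ℝ} {c : ℝ} (h : Tendsto (fun i => deriv f (g i)) l (𝓝 (deriv f c))) :
    Tendsto g l (𝓝 c) := by
  rw [tendsto_order] at h ⊢
  exact ⟨fun b hb => (h.1 _ (hf.strictMono hb)).mono fun i hi => hf.strictMono.lt_iff_lt.1 hi,
    fun b hb => (h.2 _ (hf.strictMono hb)).mono fun i hi => hf.strictMono.lt_iff_lt.1 hi⟩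

theorem IsFlux.range_mem_nhds {f : ℝ → ℝ} (hf : IsFlux f) (c : ℝ) :
    range (deriv f) ∈ 𝓝 (deriv f c) := by
  filter_upwards [Ioo_mem_nhds (hf.strictMono (sub_one_lt c)) (hf.strictMono (lt_add_one c))]
    with p hp
  exact hf.exists_deriv_eq hp.1.le hp.2.le

/-- The Legendre transform of `f`, parametrized by the dual variable:
`f*(f'(u)) = u f'(u) - f(u)`. -/
def legendre (f : ℝ → ℝ) (u : ℝ) : ℝ := u * deriv f u - f u

theorem IsFlux.continuous_legendre {f : ℝ → ℝ} (hf : IsFlux f) : Continuous (legendre f) :=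
  (continuous_id.mul hf.continuous_deriv).sub hf.contDiff.continuous

theorem IsFlux.hasDerivAt_legendre {f : ℝ → ℝ} (hf : IsFlux f) (u : ℝ) :
    HasDerivAt (legendre f) (u * deriv (deriv f) u) u := by
  have := ((hasDerivAt_id u).mul (hf.hasDerivAt_deriv u)).sub (hf.hasDerivAt u)
  refine this.congr_deriv ?_
  simp

theorem IsFlux.integral_deriv₂ {f : ℝ → ℝ} (hf : IsFlux f) (v u : ℝ) :
    ∫ s in v..u, deriv (deriv f) s = deriv f u - deriv f v :=
  intervalIntegral.integral_eq_sub_of_hasDerivAt (fun s _ => hf.hasDerivAt_deriv s)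
    (hf.continuous_deriv₂.intervalIntegrable _ _)

theorem IsFlux.integral_mul_deriv₂ {f : ℝ → ℝ} (hf : IsFlux f) (v u : ℝ) :
    ∫ s in v..u, s * deriv (deriv f) s = legendre f u - legendre f v :=
  intervalIntegral.integral_eq_sub_of_hasDerivAt (fun s _ => hf.hasDerivAt_legendre s)
    ((continuous_id.mul hf.continuous_deriv₂).intervalIntegrable _ _)

/-- The excess of the Legendre transform over its tangent:
`f*(f'(u)) - f*(f'(c)) - c (f'(u) - f'(c)) = ∫_c^u (s - c) f''(s) ds`. -/
def excess (f : ℝ → ℝ) (c u : ℝ) : ℝ :=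
  legendre f u - legendre f c - c * (deriv f u - deriv f c)

theorem IsFlux.integral_sub_mul_deriv₂ {f : ℝ → ℝ} (hf : IsFlux f) (c u : ℝ) :
    ∫ s in c..u, (s - c) * deriv (deriv f) s = excess f c u := by
  simp_rw [sub_mul]
  have h2 := hf.continuous_deriv₂
  rw [intervalIntegral.integral_sub (Continuous.intervalIntegrable (by fun_prop) _ _)
    (Continuous.intervalIntegrable (by fun_prop) _ _),
    intervalIntegral.integral_const_mul, hf.integral_mul_deriv₂, hf.integral_deriv₂]
  rfl

theorem IsFlux.excess_pos {f : ℝ → ℝ} (hf : IsFlux f) {c u : ℝ} (h : u ≠ c) :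
    0 < excess f c u := by
  have e : excess f c u = f c - f u - deriv f u * (c - u) := by
    unfold excess legendre; ring
  have hd : Differentiable ℝ f := hf.contDiff.differentiable (by norm_num)
  rw [e]
  rcases lt_or_gt_of_ne h with h | h
  · obtain ⟨ξ, hξ, h1⟩ := exists_deriv_eq_slope f h hd.continuous.continuousOn
      hd.differentiableOn
    rw [eq_div_iff (by linarith)] at h1
    nlinarith [mul_pos (sub_pos.2 (hf.strictMono hξ.1)) (sub_pos.2 h)]
  · obtain ⟨ξ, hξ, h1⟩ := exists_deriv_eq_slope f h hd.continuous.continuousOn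
      hd.differentiableOn
    rw [eq_div_iff (by linarith)] at h1
    nlinarith [mul_pos (sub_pos.2 (hf.strictMono hξ.2)) (sub_pos.2 h)]

theorem excess_self (f : ℝ → ℝ) (c : ℝ) : excess f c c = 0 := by simp [excess]

theorem IsFlux.excess_nonneg {f : ℝ → ℝ} (hf : IsFlux f) (c u : ℝ) : 0 ≤ excess f c u := by
  rcases eq_or_ne u c with rfl | h
  · rw [excess_self]
  · exact (hf.excess_pos h).le

/-- Jensen's inequality for the convex function `f*`. -/
theorem IsFlux.legendre_jensen {f : ℝ → ℝ} (hf : IsFlux f) {r s u w v : ℝ} (hr : 0 ≤ r)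
    (hs : 0 ≤ s) (h : (r + s) * deriv f v = r * deriv f u + s * deriv f w) :
    (r + s) * legendre f v ≤ r * legendre f u + s * legendre f w := by
  have h1 := mul_nonneg hr (hf.excess_nonneg v u)
  have h2 := mul_nonneg hs (hf.excess_nonneg v w)
  unfold excess at h1 h2
  have h3 : v * ((r + s) * deriv f v) = v * (r * deriv f u + s * deriv f w) := by rw [h]
  linarith

/-- The strict form of Jensen's inequality for `f*`. -/
theorem IsFlux.legendre_jensen_strict {f : ℝ → ℝ} (hf : IsFlux f) {r s u w v : ℝ} (hr : 0 < r)
    (hs : 0 < s) (huw : u ≠ w) (h : (r + s) * deriv f v = r * deriv f u + s * deriv f w) :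
    (r + s) * legendre f v < r * legendre f u + s * legendre f w := by
  have h3 : v * ((r + s) * deriv f v) = v * (r * deriv f u + s * deriv f w) := by rw [h]
  rcases eq_or_ne u v with rfl | hv
  · have h1 := mul_nonneg hr.le (hf.excess_nonneg u u)
    have h2 := mul_pos hs (hf.excess_pos huw.symm)
    unfold excess at h1 h2
    linarith
  · have h1 := mul_pos hr (hf.excess_pos hv)
    have h2 := mul_nonneg hs.le (hf.excess_nonneg v w)
    unfold excess at h1 h2
    linarith

/-- Weighted means of values of `f'` are values of `f'`. -/
theorem IsFlux.exists_deriv_mean {f : ℝ → ℝ} (hf : IsFlux f) {r s : ℝ} (hr : 0 < r)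
    (hs : 0 < s) (u w : ℝ) : ∃ v, (r + s) * deriv f v = r * deriv f u + s * deriv f w := by
  have hrs : 0 < r + s := by linarith
  obtain ⟨v, hv⟩ := hf.exists_deriv_eq (u := min u w) (v := max u w)
    (p := (r * deriv f u + s * deriv f w) / (r + s))
    (by
      rw [le_div_iff₀ hrs]
      nlinarith [hf.strictMono.monotone (min_le_left u w),
        hf.strictMono.monotone (min_le_right u w)])
    (by
      rw [div_le_iff₀ hrs]
      nlinarith [hf.strictMono.monotone (le_max_left u w),
        hf.strictMono.monotone (le_max_right u w)])
  exact ⟨v, by rw [hv]; field_simp⟩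

/-! ### Bounded initial data and the Hopf-Lax functional -/

theorem exists_ae_bound {φ : ℝ → ℝ} (hφ : MemLp φ ⊤ volume) :
    ∃ M : ℝ, 0 ≤ M ∧ ∀ᵐ x, |φ x| ≤ M := by
  refine ⟨(eLpNormEssSup φ volume).toReal, ENNReal.toReal_nonneg, ?_⟩
  have hfin : eLpNormEssSup φ volume < ⊤ := by
    simpa [eLpNorm_exponent_top] using hφ.2
  filter_upwards [ae_le_eLpNormEssSup (f := φ) (μ := volume)] with x hx
  have := (ENNReal.toReal_le_toReal (by simp) hfin.ne).2 hx
  simpa using this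

theorem intervalIntegrable_of_memLp {φ : ℝ → ℝ} (hφ : MemLp φ ⊤ volume) (a b : ℝ) :
    IntervalIntegrable φ volume a b :=
  (hφ.locallyIntegrable (by simp)).integrableOn_isCompact isCompact_uIcc |>.intervalIntegrable

theorem Phi_sub {φ : ℝ → ℝ} (hφ : MemLp φ ⊤ volume) (a b : ℝ) :
    Phi φ b - Phi φ a = ∫ x in a..b, φ x :=
  intervalIntegral.integral_interval_sub_left (intervalIntegrable_of_memLp hφ _ _)
    (intervalIntegrable_of_memLp hφ _ _)

theorem abs_Phi_sub_le {φ : ℝ → ℝ} (hφ : MemLp φ ⊤ volume) {M : ℝ}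
    (hM : ∀ᵐ x, |φ x| ≤ M) (a b : ℝ) : |Phi φ b - Phi φ a| ≤ M * |b - a| := by
  rw [Phi_sub hφ]
  exact intervalIntegral.norm_integral_le_of_norm_le_const_ae (f := φ) (hM.mono fun x hx _ => hx)

theorem continuous_Phi {φ : ℝ → ℝ} (hφ : MemLp φ ⊤ volume) : Continuous (Phi φ) :=
  intervalIntegral.continuous_primitive (fun a b => intervalIntegrable_of_memLp hφ a b) 0

/-- The Hopf-Lax functional `Φ(x - t f'(u)) + t f*(f'(u))`, which differs from `-E(u;x,t)` by a
term independent of `u`. -/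
def hopfLax (f φ : ℝ → ℝ) (u x t : ℝ) : ℝ := Phi φ (x - t * deriv f u) + t * legendre f u

theorem continuous_hopfLax {f φ : ℝ → ℝ} (hf : IsFlux f) (hφ : MemLp φ ⊤ volume) :
    Continuous fun p : ℝ × ℝ × ℝ => hopfLax f φ p.1 p.2.1 p.2.2 := by
  have h1 := hf.continuous_deriv
  have h2 := hf.continuous_legendre
  have h3 := continuous_Phi hφ
  unfold hopfLax
  fun_prop

/-- Change of variables `ξ = x - t f'(s)` in the integral defining `E`. No measurability of the
composed integrand is presupposed. -/
theorem integral_E_of_le {f φ : ℝ → ℝ} (hf : IsFlux f) (hφ : MemLp φ ⊤ volume) {x t v u : ℝ}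
    (ht : 0 < t) (h : v ≤ u) :
    IntervalIntegrable (fun s => deriv (deriv f) s * φ (x - t * deriv f s)) volume v u ∧
      t * ∫ s in v..u, deriv (deriv f) s * φ (x - t * deriv f s) =
        Phi φ (x - t * deriv f v) - Phi φ (x - t * deriv f u) := by
  have hd : ∀ s, HasDerivAt (fun s => x - t * deriv f s) (-(t * deriv (deriv f) s)) s :=
    fun s => ((hf.hasDerivAt_deriv s).const_mul t).const_sub x
  have hc : Continuous fun s => x - t * deriv f s :=
    continuous_const.sub (continuous_const.mul hf.continuous_deriv)
  have hneg : ∀ s, -(t * deriv (deriv f) s) ≤ 0 :=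
    fun s => neg_nonpos.2 (mul_nonneg ht.le (hf.nonneg s))
  have hle : x - t * deriv f u ≤ x - t * deriv f v := by
    have := mul_le_mul_of_nonneg_left (hf.strictMono.monotone h) ht.le
    linarith
  have hint := (integrableOn_Icc_deriv_smul_iff_of_deriv_nonpos (g := φ) hc.continuousOn
    (fun s _ => hd s) (fun s _ => hneg s) h).2
    ((intervalIntegrable_iff_integrableOn_Icc_of_le hle).1 (intervalIntegrable_of_memLp hφ _ _))
  have hval := integral_Icc_deriv_smul_of_deriv_nonpos (g := φ) hc.continuousOn
    (fun s _ => hd s) (fun s _ => hneg s) h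
  have e : ∀ s, deriv (deriv f) s * φ (x - t * deriv f s) =
      (-t⁻¹) * ((-(t * deriv (deriv f) s)) • φ (x - t * deriv f s)) := by
    intro s
    have : t ≠ 0 := ht.ne'
    simp only [smul_eq_mul]
    field_simp
  constructor
  · rw [intervalIntegrable_iff_integrableOn_Icc_of_le h]
    simp_rw [e]
    exact hint.const_mul _
  · rw [Phi_sub hφ, intervalIntegral.integral_of_le h, ← integral_Icc_eq_integral_Ioc,
      intervalIntegral.integral_of_le hle, ← integral_Icc_eq_integral_Ioc]
    simp_rw [e]
    rw [integral_const_mul, hval]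
    field_simp

theorem E_eq {f φ : ℝ → ℝ} (hf : IsFlux f) (hφ : MemLp φ ⊤ volume) {x t : ℝ} (ht : 0 < t)
    (u : ℝ) : E f φ u x t = hopfLax f φ 0 x t - hopfLax f φ u x t := by
  have key : IntervalIntegrable (fun s => deriv (deriv f) s * φ (x - t * deriv f s)) volume 0 u ∧
      t * ∫ s in (0 : ℝ)..u, deriv (deriv f) s * φ (x - t * deriv f s) =
        Phi φ (x - t * deriv f 0) - Phi φ (x - t * deriv f u) := by
    rcases le_total 0 u with h | h
    · exact integral_E_of_le hf hφ ht h
    · obtain ⟨h1, h2⟩ := integral_E_of_le hf hφ (x := x) ht h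
      refine ⟨h1.symm, ?_⟩
      rw [intervalIntegral.integral_symm]
      linarith
  unfold E hopfLax
  have e : ∀ s, deriv (deriv f) s * (φ (x - t * deriv f s) - s) =
      deriv (deriv f) s * φ (x - t * deriv f s) - s * deriv (deriv f) s := fun s => by ring
  simp_rw [e]
  have h2 := hf.continuous_deriv₂
  rw [intervalIntegral.integral_sub key.1 (Continuous.intervalIntegrable (by fun_prop) _ _), mul_sub, key.2,
    hf.integral_mul_deriv₂]
  ring

theorem mem_maxSet_iff {f φ : ℝ → ℝ} (hf : IsFlux f) (hφ : MemLp φ ⊤ volume) {x t : ℝ}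
    (ht : 0 < t) {w : ℝ} :
    w ∈ maxSet f φ x t ↔ ∀ v, hopfLax f φ w x t ≤ hopfLax f φ v x t := by
  unfold maxSet
  simp only [E_eq hf hφ ht, mem_ofPred_eq, sub_le_sub_iff_left]

/-! ### Existence, boundedness and upper semicontinuity of the maximum points -/

section MaxSet

variable {f φ : ℝ → ℝ} {M x t : ℝ}

theorem hopfLax_lt_of_gt (hf : IsFlux f) (hφ : MemLp φ ⊤ volume) (hM : ∀ᵐ x, |φ x| ≤ M)
    (ht : 0 < t) {u : ℝ} (hu : M < u) : hopfLax f φ M x t < hopfLax f φ u x t := by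
  have h1 := abs_Phi_sub_le hφ hM (x - t * deriv f u) (x - t * deriv f M)
  have h2 : 0 ≤ t * (deriv f u - deriv f M) :=
    mul_nonneg ht.le (sub_nonneg.2 (hf.strictMono.monotone hu.le))
  have h3 := mul_pos ht (hf.excess_pos hu.ne')
  rw [show x - t * deriv f M - (x - t * deriv f u) = t * (deriv f u - deriv f M) by ring,
    abs_of_nonneg h2] at h1
  have h4 := (abs_le.1 h1).2
  unfold hopfLax
  unfold excess at h3
  linarith

theorem hopfLax_lt_of_lt_neg (hf : IsFlux f) (hφ : MemLp φ ⊤ volume) (hM : ∀ᵐ x, |φ x| ≤ M)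
    (ht : 0 < t) {u : ℝ} (hu : u < -M) : hopfLax f φ (-M) x t < hopfLax f φ u x t := by
  have h1 := abs_Phi_sub_le hφ hM (x - t * deriv f u) (x - t * deriv f (-M))
  have h2 : t * (deriv f u - deriv f (-M)) ≤ 0 :=
    mul_nonpos_of_nonneg_of_nonpos ht.le (sub_nonpos.2 (hf.strictMono.monotone hu.le))
  have h3 := mul_pos ht (hf.excess_pos hu.ne)
  rw [show x - t * deriv f (-M) - (x - t * deriv f u) = t * (deriv f u - deriv f (-M)) by ring,
    abs_of_nonpos h2] at h1
  have h4 := (abs_le.1 h1).2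
  unfold hopfLax
  unfold excess at h3
  linarith

theorem maxSet_subset_Icc (hf : IsFlux f) (hφ : MemLp φ ⊤ volume) (hM : ∀ᵐ x, |φ x| ≤ M)
    (ht : 0 < t) : maxSet f φ x t ⊆ Icc (-M) M := by
  intro w hw
  rw [mem_maxSet_iff hf hφ ht] at hw
  constructor
  · by_contra h
    exact absurd (hw (-M)) (not_le.2 (hopfLax_lt_of_lt_neg hf hφ hM ht (not_le.1 h)))
  · by_contra h
    exact absurd (hw M) (not_le.2 (hopfLax_lt_of_gt hf hφ hM ht (not_le.1 h)))

theorem continuous_hopfLax_left (hf : IsFlux f) (hφ : MemLp φ ⊤ volume) (x t : ℝ) :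
    Continuous fun u => hopfLax f φ u x t :=
  (continuous_hopfLax hf hφ).comp (by fun_prop : Continuous fun u : ℝ => (u, x, t))

theorem maxSet_nonempty (hf : IsFlux f) (hφ : MemLp φ ⊤ volume) (ht : 0 < t) :
    (maxSet f φ x t).Nonempty := by
  obtain ⟨M, hM0, hM⟩ := exists_ae_bound hφ
  obtain ⟨w, -, hmin⟩ := (isCompact_Icc (a := -M) (b := M)).exists_isMinOn
    (nonempty_Icc.2 (by linarith)) (continuous_hopfLax_left hf hφ x t).continuousOn
  refine ⟨w, (mem_maxSet_iff hf hφ ht).2 fun v => ?_⟩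
  rcases lt_or_ge v (-M) with h | h
  · exact (hmin (left_mem_Icc.2 (by linarith))).trans (hopfLax_lt_of_lt_neg hf hφ hM ht h).le
  rcases lt_or_ge M v with h' | h'
  · exact (hmin (right_mem_Icc.2 (by linarith))).trans (hopfLax_lt_of_gt hf hφ hM ht h').le
  · exact hmin ⟨h, h'⟩

/-- The graph of the multifunction `(x,t) ↦ 𝒰(x,t)` is closed. -/
theorem mem_maxSet_of_tendsto (hf : IsFlux f) (hφ : MemLp φ ⊤ volume) (ht : 0 < t) {ι : Type*}
    {l : Filter ι} [l.NeBot] {X T u : ι → ℝ} {w : ℝ} (hX : Tendsto X l (𝓝 x))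
    (hT : Tendsto T l (𝓝 t)) (hw : Tendsto u l (𝓝 w))
    (hu : ∀ᶠ i in l, u i ∈ maxSet f φ (X i) (T i)) : w ∈ maxSet f φ x t := by
  rw [mem_maxSet_iff hf hφ ht]
  intro v
  have hc := continuous_hopfLax hf hφ
  refine le_of_tendsto_of_tendsto
    ((hc.tendsto (w, x, t)).comp (hw.prodMk_nhds (hX.prodMk_nhds hT)))
    ((hc.tendsto (v, x, t)).comp (tendsto_const_nhds.prodMk_nhds (hX.prodMk_nhds hT))) ?_
  filter_upwards [hu, hT.eventually (lt_mem_nhds ht)] with i hi hti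
  exact (mem_maxSet_iff hf hφ hti).1 hi v

/-- Upper semicontinuity of the multifunction `(x,t) ↦ 𝒰(x,t)`. -/
theorem eventually_mem_of_maxSet_subset (hf : IsFlux f) (hφ : MemLp φ ⊤ volume) (ht : 0 < t)
    {ι : Type*} {l : Filter ι} {X T u : ι → ℝ} (hX : Tendsto X l (𝓝 x))
    (hT : Tendsto T l (𝓝 t)) (hu : ∀ᶠ i in l, u i ∈ maxSet f φ (X i) (T i)) {O : Set ℝ}
    (hO : IsOpen O) (hsub : maxSet f φ x t ⊆ O) : ∀ᶠ i in l, u i ∈ O := by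
  by_contra hcon
  obtain ⟨M, -, hM⟩ := exists_ae_bound hφ
  have hne : (l ⊓ 𝓟 {i | u i ∉ O}).NeBot := frequently_mem_iff_neBot.1 (not_eventually.1 hcon)
  set U : Ultrafilter ι := Ultrafilter.of (l ⊓ 𝓟 {i | u i ∉ O}) with hU
  have hUl : (U : Filter ι) ≤ l := (Ultrafilter.of_le _).trans inf_le_left
  have hUO : ∀ᶠ i in (U : Filter ι), u i ∉ O :=
    (Ultrafilter.of_le _).trans inf_le_right (mem_principal_self _)
  have hIcc : ∀ᶠ i in (U : Filter ι), u i ∈ Icc (-M) M := by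
    filter_upwards [hUl hu, hUl (hT.eventually (lt_mem_nhds ht))] with i hi hti
    exact maxSet_subset_Icc hf hφ hM hti hi
  obtain ⟨w, -, hw⟩ := (isCompact_Icc (a := -M) (b := M)).ultrafilter_le_nhds' (U.map u) hIcc
  have hwt : Tendsto u U (𝓝 w) := hw
  have hmem : w ∈ maxSet f φ x t :=
    mem_maxSet_of_tendsto hf hφ ht (hX.mono_left hUl) (hT.mono_left hUl) hwt (hUl hu)
  obtain ⟨i, hi1, hi2⟩ := (hUO.and (hwt.eventually (hO.mem_nhds (hsub hmem)))).exists
  exact hi1 hi2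

theorem tendsto_of_maxSet_eq_singleton (hf : IsFlux f) (hφ : MemLp φ ⊤ volume) (ht : 0 < t)
    {ι : Type*} {l : Filter ι} {X T u : ι → ℝ} {c : ℝ} (hX : Tendsto X l (𝓝 x))
    (hT : Tendsto T l (𝓝 t)) (hu : ∀ᶠ i in l, u i ∈ maxSet f φ (X i) (T i))
    (hc : maxSet f φ x t = {c}) : Tendsto u l (𝓝 c) := by
  rw [(nhds_basis_opens c).tendsto_right_iff]
  rintro O ⟨hcO, hO⟩
  exact eventually_mem_of_maxSet_subset hf hφ ht hX hT hu hO (by rw [hc]; simpa using hcO)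

theorem bddBelow_maxSet (hf : IsFlux f) (hφ : MemLp φ ⊤ volume) (ht : 0 < t) :
    BddBelow (maxSet f φ x t) := by
  obtain ⟨M, -, hM⟩ := exists_ae_bound hφ
  exact bddBelow_Icc.mono (maxSet_subset_Icc hf hφ hM ht)

theorem isClosed_maxSet (hf : IsFlux f) (hφ : MemLp φ ⊤ volume) (ht : 0 < t) :
    IsClosed (maxSet f φ x t) := by
  have : maxSet f φ x t = ⋂ v, {w | hopfLax f φ w x t ≤ hopfLax f φ v x t} := by
    ext w
    simp [mem_maxSet_iff hf hφ ht]
  rw [this]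
  exact isClosed_iInter fun v =>
    isClosed_le (continuous_hopfLax_left hf hφ x t) continuous_const

theorem sol_mem_maxSet (hf : IsFlux f) (hφ : MemLp φ ⊤ volume) (ht : 0 < t) :
    sol f φ x t ∈ maxSet f φ x t :=
  (isClosed_maxSet hf hφ ht).csInf_mem (maxSet_nonempty hf hφ ht) (bddBelow_maxSet hf hφ ht)

theorem sol_le (hf : IsFlux f) (hφ : MemLp φ ⊤ volume) (ht : 0 < t) {w : ℝ}
    (hw : w ∈ maxSet f φ x t) : sol f φ x t ≤ w :=
  csInf_le (bddBelow_maxSet hf hφ ht) hw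

end MaxSet

/-! ### The value function and its right derivative -/

section Value

variable {f φ : ℝ → ℝ} {M x x' t : ℝ}

/-- The value `min_u (Φ(x - t f'(u)) + t f*(f'(u)))` of the Hopf-Lax formula: a primitive in `x`
of the entropy solution. -/
def value (f φ : ℝ → ℝ) (x t : ℝ) : ℝ := hopfLax f φ (sol f φ x t) x t

theorem value_le (hf : IsFlux f) (hφ : MemLp φ ⊤ volume) (ht : 0 < t) (v : ℝ) :
    value f φ x t ≤ hopfLax f φ v x t :=
  (mem_maxSet_iff hf hφ ht).1 (sol_mem_maxSet hf hφ ht) v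

theorem mem_maxSet_iff_value (hf : IsFlux f) (hφ : MemLp φ ⊤ volume) (ht : 0 < t) {w : ℝ} :
    w ∈ maxSet f φ x t ↔ hopfLax f φ w x t = value f φ x t := by
  constructor
  · intro h
    exact le_antisymm ((mem_maxSet_iff hf hφ ht).1 h _) (value_le hf hφ ht w)
  · intro h
    rw [mem_maxSet_iff hf hφ ht, h]
    exact value_le hf hφ ht

theorem abs_value_sub_le (hf : IsFlux f) (hφ : MemLp φ ⊤ volume) (hM : ∀ᵐ x, |φ x| ≤ M)
    (ht : 0 < t) (x x' : ℝ) : |value f φ x' t - value f φ x t| ≤ M * |x' - x| := by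
  have key : ∀ x x', value f φ x' t - value f φ x t ≤ M * |x' - x| := by
    intro x x'
    have h1 := value_le hf hφ ht (x := x') (sol f φ x t)
    have h2 := abs_Phi_sub_le hφ hM (x - t * deriv f (sol f φ x t))
      (x' - t * deriv f (sol f φ x t))
    rw [sub_sub_sub_cancel_right] at h2
    have h3 := (abs_le.1 h2).2
    have h4 : value f φ x t = hopfLax f φ (sol f φ x t) x t := rfl
    unfold hopfLax at h1 h4
    linarith
  refine abs_le.2 ⟨?_, key x x'⟩
  have := key x' x
  rw [abs_sub_comm] at this
  linarith

theorem continuous_value (hf : IsFlux f) (hφ : MemLp φ ⊤ volume) (ht : 0 < t) :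
    Continuous fun x => value f φ x t := by
  obtain ⟨M, hM0, hM⟩ := exists_ae_bound hφ
  refine (LipschitzWith.of_dist_le_mul (K := ⟨M, hM0⟩) fun x y => ?_).continuous
  exact abs_value_sub_le hf hφ hM ht y x

/-- Semiconcavity estimate: the competitor `w` for the point `x'` uses the same foot point as the
maximum point `u` for `x`. -/
theorem value_sub_le (hf : IsFlux f) (hφ : MemLp φ ⊤ volume) (ht : 0 < t) {u w : ℝ}
    (hu : u ∈ maxSet f φ x t) (hw : t * deriv f w = t * deriv f u + (x' - x)) :
    value f φ x' t - value f φ x t ≤ w * (x' - x) := by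
  have h1 := value_le hf hφ ht (x := x') w
  rw [← (mem_maxSet_iff_value hf hφ ht).1 hu]
  have h2 := mul_nonneg ht.le (hf.excess_nonneg w u)
  have h3 : x' - t * deriv f w = x - t * deriv f u := by linarith
  have h4 : w * (x' - x) = w * (t * deriv f w - t * deriv f u) := by rw [hw]; ring
  unfold hopfLax at h1 ⊢
  rw [h3] at h1
  unfold excess at h2
  linarith

/-- The right derivative of the value function is the *least* maximum point. -/
theorem hasDerivWithinAt_value (hf : IsFlux f) (hφ : MemLp φ ⊤ volume) (ht : 0 < t) (x : ℝ) :
    HasDerivWithinAt (fun x => value f φ x t) (sol f φ x t) (Ioi x) x := by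
  rw [hasDerivWithinAt_iff_tendsto_slope' (by simp), tendsto_order]
  have hlt : ∀ δ : ℝ, 0 < δ → ∀ᶠ y in 𝓝[>] x, y - x < t * δ := by
    intro δ hδ
    have : 0 < t * δ := mul_pos ht hδ
    filter_upwards [Ioo_mem_nhdsGT (show x < x + t * δ by linarith)] with y hy
    linarith [hy.2]
  constructor
  · intro b hb
    obtain ⟨b', hbb', hb'⟩ := exists_between hb
    have hev : ∀ᶠ y in 𝓝[>] x, sol f φ y t ∈ Ioi b' :=
      eventually_mem_of_maxSet_subset hf hφ ht (X := fun y => y) (T := fun _ => t)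
        (tendsto_id.mono_left nhdsWithin_le_nhds) tendsto_const_nhds
        (Eventually.of_forall fun y => sol_mem_maxSet hf hφ ht) isOpen_Ioi
        fun w hw => hb'.trans_le (sol_le hf hφ ht hw)
    filter_upwards [hev, self_mem_nhdsWithin,
      hlt _ (sub_pos.2 (hf.strictMono hbb'))] with y hy hxy hyδ
    have hxy' : 0 < y - x := sub_pos.2 hxy
    have h1 := mul_lt_mul_of_pos_left (hf.strictMono (show b' < sol f φ y t from hy)) ht
    obtain ⟨w, hw⟩ := hf.exists_deriv_eq (u := b) (v := sol f φ y t)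
      (p := deriv f (sol f φ y t) - (y - x) / t)
      (by
        have : (y - x) / t < deriv f b' - deriv f b := by rwa [div_lt_iff₀' ht]
        have := hf.strictMono (show b' < sol f φ y t from hy)
        linarith)
      (by have := div_pos hxy' ht; linarith)
    have hw' : t * deriv f w = t * deriv f (sol f φ y t) + (x - y) := by
      rw [hw]; field_simp; ring
    have hbw : b < w := by
      rw [← hf.strictMono.lt_iff_lt, ← mul_lt_mul_iff_right₀ ht]
      linarith
    have h2 := value_sub_le hf hφ ht (sol_mem_maxSet hf hφ ht) hw'
    rw [slope_def_field, lt_div_iff₀ hxy']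
    nlinarith
  · intro b hb
    filter_upwards [self_mem_nhdsWithin, hlt _ (sub_pos.2 (hf.strictMono hb))] with y hxy hyδ
    have hxy' : 0 < y - x := sub_pos.2 hxy
    obtain ⟨w, hw⟩ := hf.exists_deriv_eq (u := sol f φ x t) (v := b)
      (p := deriv f (sol f φ x t) + (y - x) / t)
      (by have := div_pos hxy' ht; linarith)
      (by
        have : (y - x) / t < deriv f b - deriv f (sol f φ x t) := by rwa [div_lt_iff₀' ht]
        linarith)
    have hw' : t * deriv f w = t * deriv f (sol f φ x t) + (y - x) := by
      rw [hw]; field_simp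
    have hbw : w < b := by
      rw [← hf.strictMono.lt_iff_lt, ← mul_lt_mul_iff_right₀ ht]
      linarith
    have h2 := value_sub_le hf hφ ht (sol_mem_maxSet hf hφ ht) hw'
    rw [slope_def_field, div_lt_iff₀ hxy']
    nlinarith

/-- The solution at a positive time is again admissible initial data; its measurability comes from
its being a right derivative. -/
theorem memLp_sol (hf : IsFlux f) (hφ : MemLp φ ⊤ volume) (ht : 0 < t) :
    MemLp (fun x => sol f φ x t) ⊤ volume := by
  obtain ⟨M, -, hM⟩ := exists_ae_bound hφ
  have e : (fun x => sol f φ x t) =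
      fun x => derivWithin (fun x => value f φ x t) (Ioi x) x := by
    ext x
    exact ((hasDerivWithinAt_value hf hφ ht x).derivWithin (uniqueDiffWithinAt_Ioi x)).symm
  refine memLp_top_of_bound ?_ M (Eventually.of_forall fun x => ?_)
  · rw [e]
    exact (measurable_derivWithin_Ioi _).aestronglyMeasurable
  · exact abs_le.2 (maxSet_subset_Icc hf hφ hM ht (sol_mem_maxSet hf hφ ht))

theorem integral_sol (hf : IsFlux f) (hφ : MemLp φ ⊤ volume) (ht : 0 < t) (a b : ℝ) :
    ∫ ξ in a..b, sol f φ ξ t = value f φ b t - value f φ a t :=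
  intervalIntegral.integral_eq_sub_of_hasDeriv_right (continuous_value hf hφ ht).continuousOn
    (fun x _ => hasDerivWithinAt_value hf hφ ht x)
    (intervalIntegrable_of_memLp (memLp_sol hf hφ ht) a b)

theorem Phi_sol (hf : IsFlux f) (hφ : MemLp φ ⊤ volume) (ht : 0 < t) (x : ℝ) :
    Phi (fun ξ => sol f φ ξ t) x = value f φ x t - value f φ 0 t :=
  integral_sol hf hφ ht 0 x

/-- If the one-sided traces of the solution agree, there is only one maximum point: the value
function is then differentiable, and its semiconcavity pins every maximum point to the
derivative. -/
theorem maxSet_eq_singleton_of_traces (hf : IsFlux f) (hφ : MemLp φ ⊤ volume) (ht : 0 < t)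
    {a : ℝ} (h1 : Tendsto (fun ξ => sol f φ ξ t) (𝓝[<] x) (𝓝 a))
    (h2 : Tendsto (fun ξ => sol f φ ξ t) (𝓝[>] x) (𝓝 a)) : maxSet f φ x t = {a} := by
  have hne : Tendsto (fun ξ => sol f φ ξ t) (𝓝[≠] x) (𝓝 a) := by
    rw [← Iio_union_Ioi, nhdsWithin_union]
    exact h1.sup h2
  have hae : Tendsto (fun ξ => sol f φ ξ t) (𝓝 x ⊓ ae volume) (𝓝 a) := by
    refine hne.mono_left (inf_le_inf_left _ ?_)
    rw [le_principal_iff]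
    exact compl_mem_ae_iff.2 (by simp)
  have hd : HasDerivAt (fun y => value f φ y t) a x := by
    have h := (intervalIntegral.integral_hasStrictDerivAt_of_tendsto_ae_right (a := 0)
      (intervalIntegrable_of_memLp (memLp_sol hf hφ ht) 0 x)
      (memLp_sol hf hφ ht).1.stronglyMeasurableAtFilter hae).hasDerivAt
    refine (h.add_const (value f φ 0 t)).congr_of_eventuallyEq (Eventually.of_forall fun y => ?_)
    simp only [integral_sol hf hφ ht]
    ring
  have hsub : ∀ u ∈ maxSet f φ x t, u = a := by
    intro u hu
    have hs := hasDerivAt_iff_tendsto_slope.1 hd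
    have hs1 : Tendsto (slope (fun y => value f φ y t) x) (𝓝[<] x) (𝓝 a) :=
      hs.mono_left (nhdsWithin_mono _ fun y hy => ne_of_lt hy)
    have hs2 : Tendsto (slope (fun y => value f φ y t) x) (𝓝[>] x) (𝓝 a) :=
      hs.mono_left (nhdsWithin_mono _ fun y hy => ne_of_gt hy)
    -- `w y` is the competitor for `y` with the foot point of `u`
    set w : ℝ → ℝ := fun y => derivInv f (deriv f u + (y - x) / t) with hwdef
    have hp : Tendsto (fun y => deriv f u + (y - x) / t) (𝓝 x) (𝓝 (deriv f u)) := by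
      have : Continuous fun y => deriv f u + (y - x) / t := by fun_prop
      simpa using this.tendsto x
    have hdw : ∀ᶠ y in 𝓝 x, deriv f (w y) = deriv f u + (y - x) / t := by
      filter_upwards [hp.eventually (hf.range_mem_nhds u)] with y hy
      exact Function.invFun_eq hy
    have hw : Tendsto w (𝓝 x) (𝓝 u) :=
      hf.tendsto_of_tendsto_deriv (hp.congr' (hdw.mono fun y hy => hy.symm))
    have hle : ∀ᶠ y in 𝓝 x, value f φ y t - value f φ x t ≤ w y * (y - x) := by
      filter_upwards [hdw] with y hy
      refine value_sub_le hf hφ ht hu ?_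
      rw [hy]; field_simp
    refine le_antisymm ?_ ?_
    · refine le_of_tendsto_of_tendsto (hw.mono_left nhdsWithin_le_nhds) hs1 ?_
      filter_upwards [nhdsWithin_le_nhds hle, self_mem_nhdsWithin] with y hy hyx
      rw [slope_def_field, le_div_iff_of_neg (sub_neg.2 hyx)]
      exact hy
    · refine le_of_tendsto_of_tendsto hs2 (hw.mono_left nhdsWithin_le_nhds) ?_
      filter_upwards [nhdsWithin_le_nhds hle, self_mem_nhdsWithin] with y hy hyx
      rw [slope_def_field, div_le_iff₀ (sub_pos.2 hyx)]
      exact hy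
  obtain ⟨u, hu⟩ := maxSet_nonempty (x := x) hf hφ ht
  refine Subset.antisymm (fun v hv => hsub v hv) ?_
  rintro v rfl
  rwa [← hsub u hu]

theorem traces_of_maxSet_eq_singleton (hf : IsFlux f) (hφ : MemLp φ ⊤ volume) (ht : 0 < t)
    {c : ℝ} (hc : maxSet f φ x t = {c}) : Tendsto (fun ξ => sol f φ ξ t) (𝓝 x) (𝓝 c) :=
  tendsto_of_maxSet_eq_singleton hf hφ ht (X := fun ξ => ξ) (T := fun _ => t) tendsto_id
    tendsto_const_nhds (Eventually.of_forall fun _ => sol_mem_maxSet hf hφ ht) hc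

end Value

/-! ### Restarting the evolution -/

section Restart

variable {f φ : ℝ → ℝ} {x τ s c : ℝ}

theorem mem_maxSet_restart_iff (hf : IsFlux f) (hφ : MemLp φ ⊤ volume) (hτ : 0 < τ)
    (hs : 0 < s) :
    c ∈ maxSet f (fun ξ => sol f φ ξ τ) (x + s * deriv f c) s ↔
      ∀ u, value f φ x τ + s * legendre f c ≤
        value f φ (x + s * deriv f c - s * deriv f u) τ + s * legendre f u := by
  rw [mem_maxSet_iff hf (memLp_sol hf hφ hτ) hs]
  refine forall_congr' fun u => ?_
  unfold hopfLax
  rw [Phi_sol hf hφ hτ, Phi_sol hf hφ hτ, add_sub_cancel_right]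
  constructor <;> intro h <;> linarith

/-- If `L_c(x₀)` is alive at time `τ + s`, then `c` is a characteristic generation value for the
restarted problem. -/
theorem mem_maxSet_restart (hf : IsFlux f) (hφ : MemLp φ ⊤ volume) (hτ : 0 < τ) (hs : 0 < s)
    {x₀ : ℝ} (h : c ∈ maxSet f φ (x₀ + (s + τ) * deriv f c) (s + τ)) :
    c ∈ maxSet f (fun ξ => sol f φ ξ τ) (x₀ + τ * deriv f c + s * deriv f c) s := by
  rw [mem_maxSet_restart_iff hf hφ hτ hs]
  intro u
  set z := x₀ + τ * deriv f c + s * deriv f c - s * deriv f u with hz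
  obtain ⟨v, hv⟩ := hf.exists_deriv_mean hs hτ u (sol f φ z τ)
  have h1 := hf.legendre_jensen hs.le hτ.le hv
  have h2 := (mem_maxSet_iff hf hφ (by linarith)).1 h v
  have h3 := value_le hf hφ hτ (x := x₀ + τ * deriv f c) c
  have h4 : value f φ z τ = hopfLax f φ (sol f φ z τ) z τ := rfl
  unfold hopfLax at h2 h3 h4
  rw [show x₀ + (s + τ) * deriv f c - (s + τ) * deriv f v = z - τ * deriv f (sol f φ z τ) by
      rw [hv, hz]; ring,
    show x₀ + (s + τ) * deriv f c - (s + τ) * deriv f c = x₀ by ring] at h2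
  rw [show x₀ + τ * deriv f c - τ * deriv f c = x₀ by ring] at h3
  linarith

/-- A characteristic of the restarted problem that starts on `L_c(x₀)` prolongs `L_c(x₀)`. -/
theorem mem_maxSet_of_restart (hf : IsFlux f) (hφ : MemLp φ ⊤ volume) (hτ : 0 < τ) (hs : 0 < s)
    {x₀ d : ℝ} (hc : c ∈ maxSet f φ (x₀ + τ * deriv f c) τ)
    (hd : d ∈ maxSet f (fun ξ => sol f φ ξ τ) (x₀ + τ * deriv f c + s * deriv f d) s) :
    c ∈ maxSet f φ (x₀ + (s + τ) * deriv f c) (s + τ) := by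
  rw [mem_maxSet_restart_iff hf hφ hτ hs] at hd
  have hval : value f φ (x₀ + τ * deriv f c) τ = Phi φ x₀ + τ * legendre f c := by
    rw [← (mem_maxSet_iff_value hf hφ hτ).1 hc]
    unfold hopfLax
    rw [add_sub_cancel_right]
  have key : ∀ v, Phi φ x₀ + τ * legendre f c + s * legendre f d ≤
      Phi φ (x₀ + τ * deriv f c + s * deriv f d - (s + τ) * deriv f v) +
        (s + τ) * legendre f v := by
    intro v
    have h1 := hd v
    have h2 := value_le hf hφ hτ (x := x₀ + τ * deriv f c + s * deriv f d - s * deriv f v) v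
    unfold hopfLax at h2
    rw [show x₀ + τ * deriv f c + s * deriv f d - s * deriv f v - τ * deriv f v =
      x₀ + τ * deriv f c + s * deriv f d - (s + τ) * deriv f v by ring] at h2
    linarith
  have hdc : d = c := by
    by_contra hne
    obtain ⟨v, hv⟩ := hf.exists_deriv_mean hs hτ d c
    have h1 := hf.legendre_jensen_strict hs hτ hne hv
    have h2 := key v
    rw [show x₀ + τ * deriv f c + s * deriv f d - (s + τ) * deriv f v = x₀ by
      rw [hv]; ring] at h2
    linarith
  subst hdc
  rw [mem_maxSet_iff hf hφ (by linarith)]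
  intro v
  have h1 := key v
  unfold hopfLax
  rw [show x₀ + (s + τ) * deriv f d - (s + τ) * deriv f d = x₀ by ring,
    show x₀ + (s + τ) * deriv f d - (s + τ) * deriv f v =
      x₀ + τ * deriv f d + s * deriv f d - (s + τ) * deriv f v by ring]
  linarith

end Restart

/-! ### The defect of a competitor along a characteristic -/

section Defect

variable {f φ : ℝ → ℝ} {x₀ c s t : ℝ}

/-- The amount by which, at time `t` on the line `L_c(x₀)`, the Hopf-Lax functional at `u` exceeds
its value at `c`. It equals `Φ(l;x₀,c) - F(l;t,c)` for `l = t (f'(c) - f'(u))`. -/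
def defect (f φ : ℝ → ℝ) (x₀ c t u : ℝ) : ℝ :=
  Phi φ (x₀ + t * (deriv f c - deriv f u)) - Phi φ x₀ + t * (legendre f u - legendre f c)

theorem defect_eq_hopfLax_sub (u : ℝ) :
    defect f φ x₀ c t u =
      hopfLax f φ u (x₀ + t * deriv f c) t - hopfLax f φ c (x₀ + t * deriv f c) t := by
  unfold defect hopfLax
  rw [add_sub_cancel_right, mul_sub, ← add_sub_assoc]
  ring

theorem mem_maxSet_iff_defect (hf : IsFlux f) (hφ : MemLp φ ⊤ volume) (ht : 0 < t) :
    c ∈ maxSet f φ (x₀ + t * deriv f c) t ↔ ∀ u, 0 ≤ defect f φ x₀ c t u := by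
  simp only [mem_maxSet_iff hf hφ ht, defect_eq_hopfLax_sub, sub_nonneg]

theorem maxSet_eq_singleton_iff (hf : IsFlux f) (hφ : MemLp φ ⊤ volume) (ht : 0 < t) :
    maxSet f φ (x₀ + t * deriv f c) t = {c} ↔ ∀ u, u ≠ c → 0 < defect f φ x₀ c t u := by
  constructor
  · intro h u hu
    have hc : c ∈ maxSet f φ (x₀ + t * deriv f c) t := by rw [h]; rfl
    refine lt_of_le_of_ne ((mem_maxSet_iff_defect hf hφ ht).1 hc u) fun h0 => hu ?_
    rw [defect_eq_hopfLax_sub, eq_comm, sub_eq_zero] at h0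
    have : u ∈ maxSet f φ (x₀ + t * deriv f c) t := by
      rw [mem_maxSet_iff_value hf hφ ht, h0]
      exact (mem_maxSet_iff_value hf hφ ht).1 hc
    rw [h] at this
    exact this
  · intro h
    refine Subset.antisymm (fun u hu => ?_) ?_
    · by_contra hne
      have h1 := h u hne
      have h2 := (mem_maxSet_iff hf hφ ht).1 hu c
      rw [defect_eq_hopfLax_sub] at h1
      linarith
    · rw [singleton_subset_iff]
      refine (mem_maxSet_iff_defect hf hφ ht).2 fun u => ?_
      rcases eq_or_ne u c with rfl | hne
      · simp [defect]
      · exact (h u hne).le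

theorem PhiLoc_eq (hφ : MemLp φ ⊤ volume) (x₀ c l : ℝ) :
    PhiLoc φ x₀ c l = Phi φ (x₀ + l) - Phi φ x₀ - c * l := by
  unfold PhiLoc
  rw [intervalIntegral.integral_sub (intervalIntegrable_of_memLp hφ _ _)
    intervalIntegrable_const, Phi_sub hφ, intervalIntegral.integral_const]
  simp [mul_comm]

theorem derivInv_of_offset (hf : IsFlux f) (ht : 0 < t) (u : ℝ) :
    derivInv f (deriv f c - t * (deriv f c - deriv f u) / t) = u := by
  rw [mul_div_cancel_left₀ _ ht.ne', sub_sub_cancel]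
  exact Function.leftInverse_invFun hf.strictMono.injective u

theorem F_of_offset (hf : IsFlux f) (ht : 0 < t) (u : ℝ) :
    F f t c (t * (deriv f c - deriv f u)) = -t * excess f c u := by
  unfold F
  rw [derivInv_of_offset hf ht, hf.integral_sub_mul_deriv₂]

theorem defect_eq_PhiLoc_add (hφ : MemLp φ ⊤ volume) (u : ℝ) :
    defect f φ x₀ c t u =
      PhiLoc φ x₀ c (t * (deriv f c - deriv f u)) + t * excess f c u := by
  rw [PhiLoc_eq hφ]
  unfold defect excess
  ring

theorem F_lt_PhiLoc_iff (hf : IsFlux f) (hφ : MemLp φ ⊤ volume) (ht : 0 < t) (u : ℝ) :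
    F f t c (t * (deriv f c - deriv f u)) < PhiLoc φ x₀ c (t * (deriv f c - deriv f u)) ↔
      0 < defect f φ x₀ c t u := by
  rw [F_of_offset hf ht, defect_eq_PhiLoc_add hφ]
  constructor <;> intro h <;> linarith

theorem strictIneq_iff (hf : IsFlux f) (hφ : MemLp φ ⊤ volume) (ht : 0 < t) :
    StrictIneq f φ x₀ c t ↔ ∀ u, u ≠ c → 0 < defect f φ x₀ c t u := by
  have hrho : ∀ u, u ≠ c → (rho f u c - c) * (t * (deriv f c - deriv f u)) =
      -t * excess f c u := by
    intro u hu
    have hne : deriv f u - deriv f c ≠ 0 := sub_ne_zero.2 (hf.strictMono.injective.ne hu)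
    rw [rho, if_neg hu, hf.integral_deriv₂, hf.integral_mul_deriv₂]
    unfold excess
    field_simp
    ring
  have hiff : ∀ u, u ≠ c →
      ((rho f (derivInv f (deriv f c - t * (deriv f c - deriv f u) / t)) c - c) *
          (t * (deriv f c - deriv f u)) <
        Phi φ (x₀ + t * (deriv f c - deriv f u)) - Phi φ x₀ - c * (t * (deriv f c - deriv f u)) ↔
      0 < defect f φ x₀ c t u) := by
    intro u hu
    rw [derivInv_of_offset hf ht, hrho u hu, ← PhiLoc_eq hφ, defect_eq_PhiLoc_add hφ]
    constructor <;> intro h <;> linarith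
  constructor
  · intro h u hu
    refine (hiff u hu).1 (h _ ?_ ⟨u, rfl⟩)
    exact mul_ne_zero ht.ne' (sub_ne_zero.2 (hf.strictMono.injective.ne hu.symm))
  · rintro h l hl ⟨u, rfl⟩
    have hu : u ≠ c := by
      rintro rfl
      simp at hl
    exact (hiff u hu).2 (h u hu)

/-- Along a characteristic, defects decrease strictly in time, in the sense that a competitor
at time `s` is dominated by one with the same foot point at any later time. -/
theorem exists_defect_lt (hf : IsFlux f) (hs : 0 < s) (hst : s < t) {u' : ℝ} (hu' : u' ≠ c) :
    ∃ u, (u' < c → u' < u ∧ u < c) ∧ (c < u' → c < u ∧ u < u') ∧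
      defect f φ x₀ c t u < defect f φ x₀ c s u' := by
  have hts : 0 < t - s := sub_pos.2 hst
  obtain ⟨u, hu⟩ := hf.exists_deriv_mean hs hts u' c
  have h1 := hf.legendre_jensen_strict hs hts hu' hu
  rw [add_sub_cancel] at hu h1
  have ht : 0 < t := hs.trans hst
  have hlt : ∀ v w, deriv f v < deriv f w → v < w := fun v w => hf.strictMono.lt_iff_lt.1
  refine ⟨u, fun h => ⟨hlt _ _ ?_, hlt _ _ ?_⟩, fun h => ⟨hlt _ _ ?_, hlt _ _ ?_⟩, ?_⟩
  · nlinarith [hf.strictMono h]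
  · nlinarith [hf.strictMono h]
  · nlinarith [hf.strictMono h]
  · nlinarith [hf.strictMono h]
  · unfold defect
    rw [show t * (deriv f c - deriv f u) = s * (deriv f c - deriv f u') by linarith]
    linarith

end Defect

/-! ### The lifespan of a characteristic and its upper bound -/

section Lifespan

variable {f φ : ℝ → ℝ} {x₀ c s t : ℝ}

theorem map_offset_nhdsLT (hf : IsFlux f) (ht : 0 < t) (c : ℝ) :
    map (fun u => t * (deriv f c - deriv f u)) (𝓝[<] c) = 𝓝[>] 0 := by
  have hcont := hf.continuous_deriv
  have hc : Continuous fun u => t * (deriv f c - deriv f u) := by fun_prop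
  refine le_antisymm ?_ fun S hS => ?_
  · refine tendsto_nhdsWithin_iff.2 ⟨?_, ?_⟩
    · simpa using (hc.tendsto c).mono_left nhdsWithin_le_nhds
    · filter_upwards [self_mem_nhdsWithin] with u hu
      exact mul_pos ht (sub_pos.2 (hf.strictMono hu))
  · obtain ⟨b, hb, hsub⟩ := (mem_nhdsLT_iff_exists_Ioo_subset).1 (mem_map.1 hS)
    filter_upwards [Ioo_mem_nhdsGT (mul_pos ht (sub_pos.2 (hf.strictMono hb)))] with l hl
    have h1 : 0 < l / t := div_pos hl.1 ht
    have h2 : l / t < deriv f c - deriv f b := by rw [div_lt_iff₀' ht]; exact hl.2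
    obtain ⟨u, hu⟩ := hf.exists_deriv_eq (u := b) (v := c) (p := deriv f c - l / t)
      (by linarith) (by linarith)
    have hmem : u ∈ Ioo b c := by
      constructor <;> rw [← hf.strictMono.lt_iff_lt] <;> linarith
    have := hsub hmem
    rw [mem_preimage, hu, sub_sub_cancel, mul_div_cancel₀ _ ht.ne'] at this
    exact this

theorem map_offset_nhdsGT (hf : IsFlux f) (ht : 0 < t) (c : ℝ) :
    map (fun u => t * (deriv f c - deriv f u)) (𝓝[>] c) = 𝓝[<] 0 := by
  have hcont := hf.continuous_deriv
  have hc : Continuous fun u => t * (deriv f c - deriv f u) := by fun_prop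
  refine le_antisymm ?_ fun S hS => ?_
  · refine tendsto_nhdsWithin_iff.2 ⟨?_, ?_⟩
    · simpa using (hc.tendsto c).mono_left nhdsWithin_le_nhds
    · filter_upwards [self_mem_nhdsWithin] with u hu
      exact mul_neg_of_pos_of_neg ht (sub_neg.2 (hf.strictMono hu))
  · obtain ⟨b, hb, hsub⟩ := (mem_nhdsGT_iff_exists_Ioo_subset).1 (mem_map.1 hS)
    filter_upwards [Ioo_mem_nhdsLT
      (mul_neg_of_pos_of_neg ht (sub_neg.2 (hf.strictMono hb)))] with l hl
    have h1 : l / t < 0 := div_neg_of_neg_of_pos hl.2 ht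
    have h2 : deriv f c - deriv f b < l / t := by rw [lt_div_iff₀' ht]; exact hl.1
    obtain ⟨u, hu⟩ := hf.exists_deriv_eq (u := c) (v := b) (p := deriv f c - l / t)
      (by linarith) (by linarith)
    have hmem : u ∈ Ioo c b := by
      constructor <;> rw [← hf.strictMono.lt_iff_lt] <;> linarith
    have := hsub hmem
    rw [mem_preimage, hu, sub_sub_cancel, mul_div_cancel₀ _ ht.ne'] at this
    exact this

theorem tpPlus_eq (hf : IsFlux f) (hφ : MemLp φ ⊤ volume) (x₀ c : ℝ) :
    tpPlus f φ x₀ c = sSup ((fun t : ℝ => (t : EReal)) ''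
      {t : ℝ | 0 < t ∧ ∀ᶠ u in 𝓝[<] c, 0 < defect f φ x₀ c t u}) := by
  unfold tpPlus
  congr 2
  ext t
  refine and_congr_right fun ht => ?_
  rw [← map_offset_nhdsLT hf ht c, eventually_map]
  simp only [F_lt_PhiLoc_iff hf hφ ht]

theorem tpMinus_eq (hf : IsFlux f) (hφ : MemLp φ ⊤ volume) (x₀ c : ℝ) :
    tpMinus f φ x₀ c = sSup ((fun t : ℝ => (t : EReal)) ''
      {t : ℝ | 0 < t ∧ ∀ᶠ u in 𝓝[>] c, 0 < defect f φ x₀ c t u}) := by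
  unfold tpMinus
  congr 2
  ext t
  refine and_congr_right fun ht => ?_
  rw [← map_offset_nhdsGT hf ht c, eventually_map]
  simp only [F_lt_PhiLoc_iff hf hφ ht]

theorem coe_le_sSup_coe {S : Set ℝ} {t : ℝ} (ht : t ∈ S) :
    (t : EReal) ≤ sSup ((fun t : ℝ => (t : EReal)) '' S) :=
  le_sSup ⟨t, ht, rfl⟩

theorem coe_lt_sSup_coe {S : Set ℝ} {t : ℝ} :
    (t : EReal) < sSup ((fun t : ℝ => (t : EReal)) '' S) ↔ ∃ s ∈ S, t < s := by
  rw [lt_sSup_iff]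
  simp

/-- Below the lifespan, `c` is the only maximum point on `L_c(x₀)`. -/
theorem defect_pos_of_lt (hf : IsFlux f) (hφ : MemLp φ ⊤ volume) (hs : 0 < s) (hst : s < t)
    (h : c ∈ maxSet f φ (x₀ + t * deriv f c) t) {u : ℝ} (hu : u ≠ c) :
    0 < defect f φ x₀ c s u := by
  obtain ⟨v, -, -, hv⟩ := exists_defect_lt (φ := φ) (x₀ := x₀) hf hs hst hu
  exact ((mem_maxSet_iff_defect hf hφ (hs.trans hst)).1 h v).trans_lt hv

theorem le_tp_of_mem (hf : IsFlux f) (hφ : MemLp φ ⊤ volume) (ht : 0 < t)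
    (h : c ∈ maxSet f φ (x₀ + t * deriv f c) t) : (t : EReal) ≤ tp f φ x₀ c := by
  refine le_of_forall_lt fun z hz => ?_
  obtain ⟨s, hzs, hst⟩ := EReal.lt_iff_exists_real_btwn.1 hz
  have hst' : max s (t / 2) < t := max_lt (EReal.coe_lt_coe_iff.1 hst) (by linarith)
  have hs0 : 0 < max s (t / 2) := lt_max_of_lt_right (by linarith)
  have hle : (s : EReal) ≤ (max s (t / 2) : ℝ) := EReal.coe_le_coe_iff.2 (le_max_left _ _)
  refine hzs.trans_le (hle.trans (le_min ?_ ?_))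
  · rw [tpPlus_eq hf hφ]
    refine coe_le_sSup_coe ⟨hs0, ?_⟩
    filter_upwards [self_mem_nhdsWithin] with u hu
    exact defect_pos_of_lt hf hφ hs0 hst' h (ne_of_lt hu)
  · rw [tpMinus_eq hf hφ]
    refine coe_le_sSup_coe ⟨hs0, ?_⟩
    filter_upwards [self_mem_nhdsWithin] with u hu
    exact defect_pos_of_lt hf hφ hs0 hst' h (ne_of_gt hu)

theorem tStar_le_tp (hf : IsFlux f) (hφ : MemLp φ ⊤ volume) (x₀ c : ℝ) :
    tStar f φ x₀ c ≤ tp f φ x₀ c := by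
  refine sSup_le ?_
  rintro _ ⟨t, ⟨ht, h⟩, rfl⟩
  exact le_tp_of_mem hf hφ ht h

theorem tp_pos (hf : IsFlux f) (hφ : MemLp φ ⊤ volume) (hc : c ∈ charValues f φ x₀) :
    0 < tp f φ x₀ c := by
  obtain ⟨t, ht, h⟩ := hc
  exact (EReal.coe_pos.2 ht).trans_le (le_tp_of_mem hf hφ ht h)

theorem mem_maxSet_of_coe_lt_tStar (hf : IsFlux f) (hφ : MemLp φ ⊤ volume) (hs : 0 < s)
    (h : (s : EReal) < tStar f φ x₀ c) : c ∈ maxSet f φ (x₀ + s * deriv f c) s := by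
  obtain ⟨t, ⟨_, hmem⟩, hst⟩ := coe_lt_sSup_coe.1 h
  rw [mem_maxSet_iff_defect hf hφ hs]
  intro u
  rcases eq_or_ne u c with rfl | hu
  · simp [defect]
  · exact (defect_pos_of_lt hf hφ hs hst hmem hu).le

/-- A characteristic with a finite lifespan is still alive at its last time. -/
theorem mem_maxSet_of_tStar_eq (hf : IsFlux f) (hφ : MemLp φ ⊤ volume) (ht : 0 < t)
    (h : tStar f φ x₀ c = (t : EReal)) : c ∈ maxSet f φ (x₀ + t * deriv f c) t := by
  have hid : Tendsto (fun s : ℝ => s) (𝓝[<] t) (𝓝 t) := tendsto_id.mono_left nhdsWithin_le_nhds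
  refine mem_maxSet_of_tendsto hf hφ ht (l := 𝓝[<] t) (X := fun s => x₀ + s * deriv f c)
    (T := fun s => s) (u := fun _ => c) ((hid.mul_const _).const_add _) hid
    tendsto_const_nhds ?_
  filter_upwards [Ioo_mem_nhdsLT ht] with s hs
  exact mem_maxSet_of_coe_lt_tStar hf hφ hs.1 (h ▸ EReal.coe_lt_coe_iff.2 hs.2)

theorem tStar_eq_of_charValuesAt_eq_empty (hf : IsFlux f) (hφ : MemLp φ ⊤ volume) (ht : 0 < t)
    (hc : c ∈ maxSet f φ (x₀ + t * deriv f c) t)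
    (hempty : charValuesAt f φ t (x₀ + t * deriv f c) = ∅) :
    tStar f φ x₀ c = (t : EReal) := by
  refine le_antisymm (not_lt.1 fun hlt => ?_) (coe_le_sSup_coe ⟨ht, hc⟩)
  obtain ⟨s, ⟨_, hs⟩, hts⟩ := coe_lt_sSup_coe.1 hlt
  have hpos : 0 < s - t := sub_pos.2 hts
  have hmem := mem_maxSet_restart (x₀ := x₀) (c := c) hf hφ ht hpos (by rwa [sub_add_cancel])
  have : c ∈ charValuesAt f φ t (x₀ + t * deriv f c) := ⟨s - t, hpos, hmem⟩
  rw [hempty] at this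
  exact this

/-- If `t_p > t`, competitors near `c` cannot beat `c` for some time after `t`; as the maximum points
depend upper semicontinuously on the time, those near the unique one at time `t` are close to `c`,
so that the characteristic outlives `t`. -/
theorem tp_eq_of_tStar_eq (hf : IsFlux f) (hφ : MemLp φ ⊤ volume) (ht : 0 < t)
    (hc : maxSet f φ (x₀ + t * deriv f c) t = {c}) (hstar : tStar f φ x₀ c = (t : EReal)) :
    tp f φ x₀ c = (t : EReal) := by
  refine le_antisymm (not_lt.1 fun hlt => ?_) (hstar ▸ tStar_le_tp hf hφ x₀ c)
  obtain ⟨hplus, hminus⟩ := lt_min_iff.1 hlt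
  rw [tpPlus_eq hf hφ, coe_lt_sSup_coe] at hplus
  rw [tpMinus_eq hf hφ, coe_lt_sSup_coe] at hminus
  obtain ⟨t₁, ⟨_, h₁⟩, ht₁⟩ := hplus
  obtain ⟨t₂, ⟨_, h₂⟩, ht₂⟩ := hminus
  obtain ⟨b₁, hb₁, hsub₁⟩ := (mem_nhdsLT_iff_exists_Ioo_subset).1 h₁
  obtain ⟨b₂, hb₂, hsub₂⟩ := (mem_nhdsGT_iff_exists_Ioo_subset).1 h₂
  have hid : Tendsto (fun s : ℝ => s) (𝓝[>] t) (𝓝 t) := tendsto_id.mono_left nhdsWithin_le_nhds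
  have hsol : Tendsto (fun s => sol f φ (x₀ + s * deriv f c) s) (𝓝[>] t) (𝓝 c) :=
    tendsto_of_maxSet_eq_singleton hf hφ ht ((hid.mul_const _).const_add _) hid
      (eventually_mem_nhdsWithin.mono fun s hs => sol_mem_maxSet hf hφ (ht.trans hs)) hc
  obtain ⟨s, hsb, hst⟩ := ((hsol.eventually (Ioo_mem_nhds hb₁ hb₂)).and
    (Ioo_mem_nhdsGT (lt_min ht₁ ht₂))).exists
  have hs : 0 < s := ht.trans hst.1
  have hmem := sol_mem_maxSet (x := x₀ + s * deriv f c) hf hφ hs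
  have hle : defect f φ x₀ c s (sol f φ (x₀ + s * deriv f c) s) ≤ 0 := by
    rw [defect_eq_hopfLax_sub, sub_nonpos]
    exact (mem_maxSet_iff hf hφ hs).1 hmem c
  rcases lt_trichotomy (sol f φ (x₀ + s * deriv f c) s) c with h | h | h
  · obtain ⟨v, hv, -, hvd⟩ := exists_defect_lt (φ := φ) (x₀ := x₀) hf hs
      (hst.2.trans_le (min_le_left _ _)) h.ne
    have : 0 < defect f φ x₀ c t₁ v := hsub₁ ⟨hsb.1.trans (hv h).1, (hv h).2⟩
    linarith
  · rw [h] at hmem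
    have : (s : EReal) ≤ tStar f φ x₀ c := coe_le_sSup_coe ⟨hs, hmem⟩
    rw [hstar, EReal.coe_le_coe_iff] at this
    exact absurd hst.1 (not_lt.2 this)
  · obtain ⟨v, -, hv, hvd⟩ := exists_defect_lt (φ := φ) (x₀ := x₀) hf hs
      (hst.2.trans_le (min_le_right _ _)) h.ne'
    have : 0 < defect f φ x₀ c t₂ v := hsub₂ ⟨(hv h).1, (hv h).2.trans hsb.2⟩
    linarith

theorem IsContShockGenPoint.exists_maxSet_eq_singleton (hf : IsFlux f) (hφ : MemLp φ ⊤ volume)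
    {x : ℝ} (h : IsContShockGenPoint f φ x t) : ∃ c, maxSet f φ x t = {c} := by
  obtain ⟨ht, ⟨a, h1, h2⟩, -⟩ := h
  exact ⟨a, maxSet_eq_singleton_of_traces hf hφ ht h1 h2⟩

theorem IsContShockGenPoint.exists_characteristic (hf : IsFlux f) (hφ : MemLp φ ⊤ volume)
    {x : ℝ} (h : IsContShockGenPoint f φ x t) :
    ∃ x₀ : ℝ, ∃ c ∈ charValues f φ x₀,
      tp f φ x₀ c = (t : EReal) ∧ tStar f φ x₀ c = (t : EReal) ∧ x = x₀ + t * deriv f c := by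
  obtain ⟨c, hc⟩ := h.exists_maxSet_eq_singleton hf hφ
  have ht := h.1
  obtain ⟨x₀, rfl⟩ : ∃ x₀, x = x₀ + t * deriv f c := ⟨x - t * deriv f c, by ring⟩
  have hmem : c ∈ maxSet f φ (x₀ + t * deriv f c) t := by rw [hc]; rfl
  have hstar := tStar_eq_of_charValuesAt_eq_empty hf hφ ht hmem h.2.2
  exact ⟨x₀, c, ⟨t, ht, hmem⟩, tp_eq_of_tStar_eq hf hφ ht hc hstar, hstar, rfl⟩

/-- A characteristic which is alive up to `t = t_p` and at that time the unique maximum point ends in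
a continuous shock generation point: a restarted characteristic would prolong it. -/
theorem isContShockGenPoint_of_unique (hf : IsFlux f) (hφ : MemLp φ ⊤ volume) (ht : 0 < t)
    (hc : maxSet f φ (x₀ + t * deriv f c) t = {c}) (hle : tp f φ x₀ c ≤ (t : EReal)) :
    IsContShockGenPoint f φ (x₀ + t * deriv f c) t := by
  have htr := traces_of_maxSet_eq_singleton hf hφ ht hc
  refine ⟨ht, ⟨c, htr.mono_left nhdsWithin_le_nhds, htr.mono_left nhdsWithin_le_nhds⟩, ?_⟩
  refine eq_empty_iff_forall_notMem.2 ?_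
  rintro d ⟨s, hs, hd⟩
  have hmem : c ∈ maxSet f φ (x₀ + t * deriv f c) t := by rw [hc]; rfl
  have hmem' := mem_maxSet_of_restart hf hφ ht hs hmem hd
  have h1 := (le_tp_of_mem hf hφ (by linarith) hmem').trans hle
  rw [EReal.coe_le_coe_iff] at h1
  linarith

theorem contShockGenPoint_iff (hf : IsFlux f) (hφ : MemLp φ ⊤ volume)
    (hT : tp f φ x₀ c = (t : EReal)) (ht : 0 < t) :
    (tStar f φ x₀ c = (t : EReal) ∧ IsContShockGenPoint f φ (x₀ + t * deriv f c) t) ↔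
      StrictIneq f φ x₀ c t := by
  rw [strictIneq_iff hf hφ ht, ← maxSet_eq_singleton_iff hf hφ ht]
  constructor
  · rintro ⟨hstar, hgen⟩
    obtain ⟨a, ha⟩ := hgen.exists_maxSet_eq_singleton hf hφ
    have hmem := mem_maxSet_of_tStar_eq hf hφ ht hstar
    rw [ha] at hmem ⊢
    rw [mem_singleton_iff.1 hmem]
  · intro hc
    have hmem : c ∈ maxSet f φ (x₀ + t * deriv f c) t := by rw [hc]; rfl
    exact ⟨le_antisymm (hT ▸ tStar_le_tp hf hφ x₀ c) (coe_le_sSup_coe ⟨ht, hmem⟩),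
      isContShockGenPoint_of_unique hf hφ ht hc hT.le⟩

theorem exists_real_of_mem_Ioo {z : EReal} (h : z ∈ Ioo (0 : EReal) ⊤) :
    ∃ t : ℝ, 0 < t ∧ z = t := by
  lift z to ℝ using ⟨h.2.ne, (EReal.bot_lt_zero.trans h.1).ne'⟩
  exact ⟨z, EReal.coe_pos.1 h.1, rfl⟩

end Lifespan

/-! ### Dini derivatives and characteristic generation values -/

section Dini

variable {f φ : ℝ → ℝ} {x₀ c t : ℝ}

theorem sSup_coe_eq_top {S : Set ℝ} (h : ∀ t, 0 < t → t ∈ S) :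
    sSup ((fun t : ℝ => (t : EReal)) '' S) = ⊤ := by
  rw [EReal.eq_top_iff_forall_lt]
  intro y
  exact coe_lt_sSup_coe.2 ⟨max y 0 + 1, h _ (by positivity), by linarith [le_max_left y 0]⟩

/-- Tangents to `f*` bound the increments of `Φ` from `x₀` from below. -/
theorem mul_offset_le_Phi_sub (hf : IsFlux f) (hφ : MemLp φ ⊤ volume) (ht : 0 < t)
    (h : c ∈ maxSet f φ (x₀ + t * deriv f c) t) (u : ℝ) :
    u * (t * (deriv f c - deriv f u)) ≤
      Phi φ (x₀ + t * (deriv f c - deriv f u)) - Phi φ x₀ := by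
  have h1 := (mem_maxSet_iff_defect hf hφ ht).1 h u
  have h2 := mul_nonneg ht.le (hf.excess_nonneg u c)
  unfold defect at h1
  unfold excess at h2
  linarith

theorem abs_slope_Phi_le (hφ : MemLp φ ⊤ volume) {M : ℝ} (hM : ∀ᵐ x, |φ x| ≤ M) {l : ℝ}
    (hl : l ≠ 0) : |(Phi φ (x₀ + l) - Phi φ x₀) / l| ≤ M := by
  rw [abs_div, div_le_iff₀ (abs_pos.2 hl)]
  simpa using abs_Phi_sub_le hφ hM x₀ (x₀ + l)

theorem isBoundedUnder_slope_Phi (hφ : MemLp φ ⊤ volume) (x₀ : ℝ) :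
    (𝓝[≠] (0 : ℝ)).IsBoundedUnder (· ≤ ·) (fun l => (Phi φ (x₀ + l) - Phi φ x₀) / l) ∧
      (𝓝[≠] (0 : ℝ)).IsBoundedUnder (· ≥ ·) (fun l => (Phi φ (x₀ + l) - Phi φ x₀) / l) := by
  obtain ⟨M, -, hM⟩ := exists_ae_bound hφ
  constructor
  · refine isBoundedUnder_of_eventually_le (a := M) ?_
    filter_upwards [self_mem_nhdsWithin] with l hl
    exact (abs_le.1 (abs_slope_Phi_le hφ hM hl)).2
  · refine isBoundedUnder_of_eventually_ge (a := -M) ?_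
    filter_upwards [self_mem_nhdsWithin] with l hl
    exact (abs_le.1 (abs_slope_Phi_le hφ hM hl)).1

theorem nhdsGT_le_nhdsNE (a : ℝ) : 𝓝[>] a ≤ 𝓝[≠] a := nhdsWithin_mono _ fun _ h => ne_of_gt h

theorem nhdsLT_le_nhdsNE (a : ℝ) : 𝓝[<] a ≤ 𝓝[≠] a := nhdsWithin_mono _ fun _ h => ne_of_lt h

theorem le_lowerRightDini (hf : IsFlux f) (hφ : MemLp φ ⊤ volume)
    (hc : c ∈ charValues f φ x₀) : c ≤ lowerRightDini φ x₀ := by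
  obtain ⟨t, ht, h⟩ := hc
  refine le_of_forall_lt fun b hb => ?_
  obtain ⟨b', hbb', hb'⟩ := exists_between hb
  refine hbb'.trans_le (le_liminf_of_le
    ((isBoundedUnder_slope_Phi hφ x₀).1.mono (nhdsGT_le_nhdsNE 0)).isCoboundedUnder_ge ?_)
  rw [← map_offset_nhdsLT hf ht c, eventually_map]
  filter_upwards [Ioo_mem_nhdsLT hb'] with u hu
  have hl : 0 < t * (deriv f c - deriv f u) := mul_pos ht (sub_pos.2 (hf.strictMono hu.2))
  rw [le_div_iff₀ hl]
  exact (mul_le_mul_of_nonneg_right hu.1.le hl.le).trans (mul_offset_le_Phi_sub hf hφ ht h u)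

theorem upperLeftDini_le (hf : IsFlux f) (hφ : MemLp φ ⊤ volume)
    (hc : c ∈ charValues f φ x₀) : upperLeftDini φ x₀ ≤ c := by
  obtain ⟨t, ht, h⟩ := hc
  refine le_of_forall_gt fun b hb => ?_
  obtain ⟨b', hb', hbb'⟩ := exists_between hb
  refine lt_of_le_of_lt (limsup_le_of_le
    ((isBoundedUnder_slope_Phi hφ x₀).2.mono (nhdsLT_le_nhdsNE 0)).isCoboundedUnder_le ?_) hbb'
  rw [← map_offset_nhdsGT hf ht c, eventually_map]
  filter_upwards [Ioo_mem_nhdsGT hb'] with u hu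
  have hl : t * (deriv f c - deriv f u) < 0 :=
    mul_neg_of_pos_of_neg ht (sub_neg.2 (hf.strictMono hu.1))
  rw [div_le_iff_of_neg hl]
  exact (mul_le_mul_of_nonpos_right hu.2.le hl.le).trans (mul_offset_le_Phi_sub hf hφ ht h u)

theorem tpPlus_eq_top (hf : IsFlux f) (hφ : MemLp φ ⊤ volume) (hc : c < lowerRightDini φ x₀) :
    tpPlus f φ x₀ c = ⊤ := by
  rw [tpPlus_eq hf hφ]
  refine sSup_coe_eq_top fun t ht => ⟨ht, ?_⟩
  have h := eventually_lt_of_lt_liminf hc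
    ((isBoundedUnder_slope_Phi hφ x₀).2.mono (nhdsGT_le_nhdsNE 0))
  rw [← map_offset_nhdsLT hf ht c, eventually_map] at h
  filter_upwards [h, self_mem_nhdsWithin] with u hu huc
  have hl : 0 < t * (deriv f c - deriv f u) := mul_pos ht (sub_pos.2 (hf.strictMono huc))
  rw [lt_div_iff₀ hl] at hu
  have h2 := mul_nonneg ht.le (hf.excess_nonneg c u)
  rw [defect_eq_PhiLoc_add hφ, PhiLoc_eq hφ]
  linarith

theorem tpMinus_eq_top (hf : IsFlux f) (hφ : MemLp φ ⊤ volume) (hc : upperLeftDini φ x₀ < c) :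
    tpMinus f φ x₀ c = ⊤ := by
  rw [tpMinus_eq hf hφ]
  refine sSup_coe_eq_top fun t ht => ⟨ht, ?_⟩
  have h := eventually_lt_of_limsup_lt hc
    ((isBoundedUnder_slope_Phi hφ x₀).1.mono (nhdsLT_le_nhdsNE 0))
  rw [← map_offset_nhdsGT hf ht c, eventually_map] at h
  filter_upwards [h, self_mem_nhdsWithin] with u hu huc
  have hl : t * (deriv f c - deriv f u) < 0 :=
    mul_neg_of_pos_of_neg ht (sub_neg.2 (hf.strictMono huc))
  rw [div_lt_iff_of_neg hl] at hu
  have h2 := mul_nonneg ht.le (hf.excess_nonneg c u)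
  rw [defect_eq_PhiLoc_add hφ, PhiLoc_eq hφ]
  linarith

end Dini

/-! ### Power-law asymptotics -/

theorem tendsto_integral_div_rpow {h : ℝ → ℝ} {γ C : ℝ} (hγ : 0 ≤ γ)
    (hint : ∀ r, IntervalIntegrable h volume 0 r)
    (hlim : Tendsto (fun y => h y / y ^ γ) (𝓝[>] 0 ⊓ ae volume) (𝓝 C)) :
    Tendsto (fun r => (∫ y in (0 : ℝ)..r, h y) / r ^ (γ + 1)) (𝓝[>] 0) (𝓝 (C / (γ + 1))) := by
  have hγ1 : 0 < γ + 1 := by linarith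
  rw [Metric.tendsto_nhds]
  intro ε hε
  obtain ⟨s, hs, A, hA, hsA⟩ := eventually_inf.1 (Metric.tendsto_nhds.1 hlim (ε / 2) (half_pos hε))
  obtain ⟨δ, hδ, hsub⟩ := (mem_nhdsGT_iff_exists_Ioo_subset).1 hs
  filter_upwards [Ioo_mem_nhdsGT hδ] with r hr
  have hpow : ∀ b : ℝ, IntervalIntegrable (fun y : ℝ => b * y ^ γ) volume 0 r := fun b =>
    (intervalIntegral.intervalIntegrable_rpow' (by linarith)).const_mul b
  have hval : ∀ b : ℝ, ∫ y in (0 : ℝ)..r, b * y ^ γ = b * r ^ (γ + 1) / (γ + 1) := by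
    intro b
    rw [intervalIntegral.integral_const_mul, integral_rpow (Or.inl (by linarith)),
      Real.zero_rpow hγ1.ne', sub_zero, mul_div_assoc]
  have hle : ‖∫ y in (0 : ℝ)..r, (h y - C * y ^ γ)‖ ≤ ∫ y in (0 : ℝ)..r, ε / 2 * y ^ γ := by
    refine intervalIntegral.norm_integral_le_of_norm_le hr.1.le ?_ (hpow _)
    filter_upwards [hA] with y hy hyr
    have hy0 : 0 < y ^ γ := Real.rpow_pos_of_pos hyr.1 γ
    have h1 := hsA y ⟨hsub ⟨hyr.1, hyr.2.trans_lt hr.2⟩, hy⟩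
    rw [Real.dist_eq] at h1
    rw [show h y - C * y ^ γ = (h y / y ^ γ - C) * y ^ γ by field_simp, norm_mul,
      Real.norm_eq_abs, Real.norm_eq_abs, abs_of_pos hy0]
    exact mul_le_mul_of_nonneg_right h1.le hy0.le
  rw [intervalIntegral.integral_sub (hint r) (hpow C), hval, hval, Real.norm_eq_abs] at hle
  have hr0 : 0 < r ^ (γ + 1) := Real.rpow_pos_of_pos hr.1 _
  rw [Real.dist_eq, show (∫ y in (0 : ℝ)..r, h y) / r ^ (γ + 1) - C / (γ + 1) =
    ((∫ y in (0 : ℝ)..r, h y) - C * r ^ (γ + 1) / (γ + 1)) / r ^ (γ + 1) by field_simp,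
    abs_div, abs_of_pos hr0, div_lt_iff₀ hr0]
  refine hle.trans_lt ?_
  rw [div_lt_iff₀ hγ1]
  nlinarith [mul_pos hε hr0, mul_nonneg (mul_pos hε hr0).le hγ]

section Side

variable {f φ : ℝ → ℝ} {x₀ c t σ α N γ C : ℝ}

theorem deriv_sub_deriv_eq (hf : IsFlux f) (c σ w : ℝ) :
    deriv f c - deriv f (c - σ * w) = σ * ∫ v in (0 : ℝ)..w, deriv (deriv f) (c - σ * v) := by
  have h := intervalIntegral.smul_integral_comp_mul_add (a := 0) (b := w) (deriv (deriv f)) (-σ) c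
  rw [hf.integral_deriv₂, mul_zero, zero_add] at h
  simp only [neg_mul, neg_add_eq_sub, smul_eq_mul] at h
  linarith

theorem excess_eq_integral (hf : IsFlux f) (hσ : σ * σ = 1) (c w : ℝ) :
    excess f c (c - σ * w) = ∫ v in (0 : ℝ)..w, deriv (deriv f) (c - σ * v) * v := by
  have h := intervalIntegral.smul_integral_comp_mul_add (a := 0) (b := w)
    (fun s => (s - c) * deriv (deriv f) s) (-σ) c
  simp only [mul_zero, zero_add, hf.integral_sub_mul_deriv₂] at h
  rw [smul_eq_mul, ← intervalIntegral.integral_const_mul] at h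
  simp only [neg_mul, neg_add_eq_sub] at h
  rw [← h]
  refine intervalIntegral.integral_congr fun v _ => ?_
  linear_combination (v * deriv (deriv f) (c - σ * v)) * hσ

theorem PhiLoc_mul_eq (x₀ c σ r : ℝ) :
    PhiLoc φ x₀ c (σ * r) = ∫ y in (0 : ℝ)..r, σ * (φ (σ * y + x₀) - c) := by
  have h := intervalIntegral.smul_integral_comp_mul_add (a := 0) (b := r)
    (fun ξ => φ ξ - c) σ x₀
  rw [mul_zero, zero_add, add_comm (σ * r) x₀, smul_eq_mul,
    ← intervalIntegral.integral_const_mul] at h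
  exact h.symm

/-- Leading-order asymptotics, as `w → 0+`, of the two parts of the defect at `u = c - σ w`. -/
theorem tendsto_defect_parts (hf : IsFlux f) (hφ : MemLp φ ⊤ volume) (hσ : σ * σ = 1)
    (ht : 0 < t) (hα : 0 ≤ α) (hγ : 0 < γ) (hN : 0 < N)
    (hflux : Tendsto (fun w => deriv (deriv f) (c - σ * w) / w ^ α) (𝓝[>] 0) (𝓝 N))
    (hdata : Tendsto (fun y => σ * (φ (σ * y + x₀) - c) / y ^ γ) (𝓝[>] 0 ⊓ ae volume) (𝓝 C)) :
    Tendsto (fun w => PhiLoc φ x₀ c (t * (deriv f c - deriv f (c - σ * w))) /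
        w ^ ((α + 1) * (γ + 1))) (𝓝[>] 0)
      (𝓝 (C / (γ + 1) * (t * (N / (α + 1))) ^ (γ + 1))) ∧
    Tendsto (fun w => t * excess f c (c - σ * w) / w ^ (α + 2)) (𝓝[>] 0)
      (𝓝 (t * (N / (α + 2)))) := by
  have hcont : Continuous fun v => deriv (deriv f) (c - σ * v) :=
    hf.continuous_deriv₂.comp (by fun_prop)
  set K : ℝ → ℝ := fun w => ∫ v in (0 : ℝ)..w, deriv (deriv f) (c - σ * v) with hK
  have hKlim : Tendsto (fun w => K w / w ^ (α + 1)) (𝓝[>] 0) (𝓝 (N / (α + 1))) :=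
    tendsto_integral_div_rpow hα (fun r => hcont.intervalIntegrable _ _)
      (hflux.mono_left inf_le_left)
  have hKpos : ∀ᶠ w in 𝓝[>] 0, 0 < t * K w := by
    have hNα : 0 < N / (α + 1) := by positivity
    filter_upwards [hKlim.eventually (lt_mem_nhds hNα), self_mem_nhdsWithin] with w hw hw0
    have hw1 : 0 < w ^ (α + 1) := Real.rpow_pos_of_pos hw0 _
    exact mul_pos ht ((div_pos_iff_of_pos_right hw1).1 hw)
  constructor
  · have hKto : Tendsto (fun w => t * K w) (𝓝[>] 0) (𝓝[>] 0) := by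
      refine tendsto_nhdsWithin_iff.2 ⟨?_, hKpos⟩
      have hc : Continuous K :=
        intervalIntegral.continuous_primitive (fun a b => hcont.intervalIntegrable a b) 0
      have hK0 : t * K 0 = 0 := by simp [hK]
      have h0 : Tendsto (fun w => t * K w) (𝓝 0) (𝓝 (t * K 0)) := (hc.tendsto 0).const_mul t
      rw [hK0] at h0
      exact h0.mono_left nhdsWithin_le_nhds
    have hh : ∀ r, IntervalIntegrable (fun y => σ * (φ (σ * y + x₀) - c)) volume 0 r := by
      intro r
      rcases mul_self_eq_one_iff.1 hσ with rfl | rfl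
      · have := (intervalIntegrable_of_memLp hφ (0 + x₀) (r + x₀)).comp_add_right x₀
        simp only [add_sub_cancel_right] at this
        simpa using this.sub intervalIntegrable_const
      · have := (intervalIntegrable_of_memLp hφ (x₀ - 0) (x₀ - r)).comp_sub_left x₀
        simp only [sub_sub_cancel] at this
        simpa [neg_add_eq_sub] using (intervalIntegrable_const (c := c)).sub this
    have h1 := (tendsto_integral_div_rpow hγ.le hh hdata).comp hKto
    have h2 : Tendsto (fun w => (t * (K w / w ^ (α + 1))) ^ (γ + 1)) (𝓝[>] 0)
        (𝓝 ((t * (N / (α + 1))) ^ (γ + 1))) :=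
      (hKlim.const_mul t).rpow_const (Or.inr (by linarith))
    refine (h1.mul h2).congr' ?_
    filter_upwards [hKpos, self_mem_nhdsWithin] with w hw hw0
    have hw0' : (0 : ℝ) ≤ w := le_of_lt hw0
    have hw1 : 0 < w ^ (α + 1) := Real.rpow_pos_of_pos hw0 _
    have hp1 : (t * K w) ^ (γ + 1) ≠ 0 := (Real.rpow_pos_of_pos hw _).ne'
    rw [deriv_sub_deriv_eq hf, mul_left_comm, PhiLoc_mul_eq, ← mul_div_assoc,
      Real.div_rpow hw.le hw1.le, ← Real.rpow_mul hw0']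
    simp only [Function.comp_apply]
    rw [show (∫ v in (0 : ℝ)..w, deriv (deriv f) (c - σ * v)) = K w from rfl]
    field_simp
  · have h3 := tendsto_integral_div_rpow (h := fun v => deriv (deriv f) (c - σ * v) * v)
      (γ := α + 1) (C := N) (by linarith)
      (fun r => (hcont.mul continuous_id).intervalIntegrable _ _) (by
        refine (hflux.mono_left inf_le_left).congr' ?_
        filter_upwards [inf_le_left (a := 𝓝[>] (0 : ℝ)) self_mem_nhdsWithin] with w hw
        have hw' : (0 : ℝ) < w := hw
        rw [Real.rpow_add_one hw'.ne', mul_div_mul_right _ _ hw'.ne'])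
    rw [show α + 1 + 1 = α + 2 by ring] at h3
    refine (h3.const_mul t).congr fun w => ?_
    rw [excess_eq_integral hf hσ, mul_div_assoc]

/-- At the critical exponent, the sign of the leading coefficient of the defect is that of
`(γ N |C|^{1+α})⁻¹ - t`. -/
theorem leading_coeff_eq (ht : 0 < t) (hα : 0 ≤ α) (hN : 0 < N) (hC : C < 0)
    (hcrit : γ * (1 + α) = 1) :
    C / (γ + 1) * (t * (N / (α + 1))) ^ (γ + 1) + t * (N / (α + 2)) =
      t * (N / (α + 2)) * (1 - (t / focusTime γ N C α) ^ γ) := by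
  have hα1 : 0 < 1 + α := by linarith
  have hγ : γ = (1 + α)⁻¹ := eq_inv_of_mul_eq_one_left hcrit
  have hγ0 : 0 < γ := by rw [hγ]; positivity
  have hX : 0 < t * (N / (α + 1)) := by positivity
  have e1 : t / focusTime γ N C α = t * (N / (α + 1)) * |C| ^ (1 + α) := by
    rw [focusTime, div_inv_eq_mul, hγ, add_comm α 1]
    ring
  rw [e1, Real.mul_rpow hX.le (by positivity), ← Real.rpow_mul (abs_nonneg C),
    mul_comm (1 + α) γ, hcrit, Real.rpow_one, abs_of_neg hC, Real.rpow_add_one hX.ne']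
  have e2 : γ + 1 = (α + 2) / (α + 1) := by
    rw [hγ, add_comm 1 α]
    field_simp
    ring
  generalize (t * (N / (α + 1))) ^ γ = Y
  rw [e2]
  have : α + 1 ≠ 0 := by linarith
  have : α + 2 ≠ 0 := by linarith
  field_simp
  ring

/-- One-sided upper bound of the lifespan under power laws. For `C > 0` both parts of the defect
are positive; for `C < 0` the part with the smaller exponent decides, and at equal exponents the
leading coefficient does. The case where the data part always wins is excluded by
positivity of the upper bound. -/
theorem sSup_of_powerLaws (hf : IsFlux f) (hφ : MemLp φ ⊤ volume) (hσ : σ * σ = 1)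
    (hα : 0 ≤ α) (hN : 0 < N) (hγ : 0 < γ) (hC : C ≠ 0)
    (hflux : Tendsto (fun w => deriv (deriv f) (c - σ * w) / w ^ α) (𝓝[>] 0) (𝓝 N))
    (hdata : Tendsto (fun y => σ * (φ (σ * y + x₀) - c) / y ^ γ) (𝓝[>] 0 ⊓ ae volume) (𝓝 C))
    {z : EReal} (hz : z = sSup ((fun t : ℝ => (t : EReal)) ''
      {t : ℝ | 0 < t ∧ ∀ᶠ w in 𝓝[>] 0, 0 < defect f φ x₀ c t (c - σ * w)}))
    (hz0 : 0 < z) :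
    (z ∈ Ioo (0 : EReal) ⊤ ↔ C < 0 ∧ γ * (1 + α) = 1) ∧
      (z ∈ Ioo (0 : EReal) ⊤ → z = (focusTime γ N C α : EReal)) := by
  set S : Set ℝ := {t : ℝ | 0 < t ∧ ∀ᶠ w in 𝓝[>] 0, 0 < defect f φ x₀ c t (c - σ * w)} with hS
  have hparts := fun t ht => tendsto_defect_parts (t := t) hf hφ hσ ht hα hγ hN hflux hdata
  have hnotop : z = ⊤ → z ∉ Ioo (0 : EReal) ⊤ := fun h h' => h'.2.ne h
  have hpos : ∀ e : ℝ, ∀ᶠ w in 𝓝[>] (0 : ℝ), 0 < w ^ e := fun e => by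
    filter_upwards [self_mem_nhdsWithin] with w hw
    exact Real.rpow_pos_of_pos hw e
  rcases lt_or_gt_of_ne hC with hC | hC
  swap
  · -- both parts of the defect are eventually positive
    have htop : z = ⊤ := by
      rw [hz]
      refine sSup_coe_eq_top fun t ht => ⟨ht, ?_⟩
      have hp : 0 < C / (γ + 1) * (t * (N / (α + 1))) ^ (γ + 1) := by positivity
      filter_upwards [(hparts t ht).1.eventually (lt_mem_nhds hp),
        hpos ((α + 1) * (γ + 1))] with w hw hw1
      rw [defect_eq_PhiLoc_add hφ]
      exact add_pos_of_pos_of_nonneg ((div_pos_iff_of_pos_right hw1).1 hw)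
        (mul_nonneg ht.le (hf.excess_nonneg _ _))
    exact ⟨⟨fun h => absurd h (hnotop htop), fun h => absurd h.1 (not_lt.2 hC.le)⟩,
      fun h => absurd h (hnotop htop)⟩
  have hrpow0 : ∀ e : ℝ, 0 < e → Tendsto (fun w : ℝ => w ^ e) (𝓝[>] 0) (𝓝 0) := by
    intro e he
    have := (Real.continuousAt_rpow_const 0 e (Or.inr he.le)).tendsto
    rw [Real.zero_rpow he.ne'] at this
    exact this.mono_left nhdsWithin_le_nhds
  have hexp : (α + 1) * (γ + 1) = α + 2 + (γ * (1 + α) - 1) := by ring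
  rcases lt_trichotomy (γ * (1 + α)) 1 with he | he | he
  · -- the data part has the smaller exponent: the defect is eventually negative at every time
    have hempty : S = ∅ := by
      refine eq_empty_iff_forall_notMem.2 ?_
      rintro t ⟨ht, hev⟩
      have hX : 0 < (t * (N / (α + 1))) ^ (γ + 1) := by positivity
      have hlim : Tendsto (fun w => defect f φ x₀ c t (c - σ * w) / w ^ ((α + 1) * (γ + 1)))
          (𝓝[>] 0) (𝓝 (C / (γ + 1) * (t * (N / (α + 1))) ^ (γ + 1) + t * (N / (α + 2)) * 0)) := by
        refine ((hparts t ht).1.add ((hparts t ht).2.mul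
          (hrpow0 (1 - γ * (1 + α)) (by linarith)))).congr' ?_
        filter_upwards [self_mem_nhdsWithin, hpos (α + 2), hpos ((α + 1) * (γ + 1))]
          with w hw hw1 hw2
        rw [defect_eq_PhiLoc_add hφ, add_div]
        congr 1
        rw [show w ^ (α + 2) = w ^ ((α + 1) * (γ + 1)) * w ^ (1 - γ * (1 + α)) by
          rw [← Real.rpow_add hw]; congr 1; linarith]
        have hw3 : w ^ (1 - γ * (1 + α)) ≠ 0 := (Real.rpow_pos_of_pos hw _).ne'
        field_simp
      rw [mul_zero, add_zero] at hlim
      have hneg : C / (γ + 1) * (t * (N / (α + 1))) ^ (γ + 1) < 0 :=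
        mul_neg_of_neg_of_pos (div_neg_of_neg_of_pos hC (by linarith)) hX
      obtain ⟨w, hw, hw1, hw2⟩ := ((hlim.eventually (gt_mem_nhds hneg)).and
        ((hpos ((α + 1) * (γ + 1))).and hev)).exists
      exact absurd hw (not_lt.2 (div_pos hw2 hw1).le)
    rw [hz, hempty, image_empty, sSup_empty] at hz0
    exact absurd hz0 not_lt_bot
  · -- equal exponents
    have hT : 0 < focusTime γ N C α := by
      have : 0 < |C| := abs_pos.2 hC.ne
      unfold focusTime
      positivity
    have hlim : ∀ t, 0 < t → Tendsto
        (fun w => defect f φ x₀ c t (c - σ * w) / w ^ (α + 2)) (𝓝[>] 0)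
        (𝓝 (t * (N / (α + 2)) * (1 - (t / focusTime γ N C α) ^ γ))) := by
      intro t ht
      rw [← leading_coeff_eq ht hα hN hC he]
      have h1 := (hparts t ht).1
      rw [hexp, he, sub_self, add_zero] at h1
      refine (h1.add (hparts t ht).2).congr fun w => ?_
      rw [defect_eq_PhiLoc_add hφ, add_div]
    have hlt : ∀ t, 0 < t → t < focusTime γ N C α → t ∈ S := by
      intro t ht htT
      have hcoef : 0 < t * (N / (α + 2)) * (1 - (t / focusTime γ N C α) ^ γ) := by
        have : (t / focusTime γ N C α) ^ γ < 1 :=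
          Real.rpow_lt_one (by positivity) ((div_lt_one hT).2 htT) hγ
        exact mul_pos (by positivity) (by linarith)
      refine ⟨ht, ?_⟩
      filter_upwards [(hlim t ht).eventually (lt_mem_nhds hcoef), hpos (α + 2)] with w hw hw1
      exact (div_pos_iff_of_pos_right hw1).1 hw
    have hgt : ∀ t ∈ S, t ≤ focusTime γ N C α := by
      rintro t ⟨ht, hev⟩
      by_contra htT
      have hcoef : t * (N / (α + 2)) * (1 - (t / focusTime γ N C α) ^ γ) < 0 := by
        have : 1 < (t / focusTime γ N C α) ^ γ :=
          Real.one_lt_rpow ((one_lt_div hT).2 (not_le.1 htT)) hγ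
        exact mul_neg_of_pos_of_neg (by positivity) (by linarith)
      obtain ⟨w, hw, hw1, hw2⟩ := (((hlim t ht).eventually (gt_mem_nhds hcoef)).and
        ((hpos (α + 2)).and hev)).exists
      exact absurd hw (not_lt.2 (div_pos hw2 hw1).le)
    have hzT : z = (focusTime γ N C α : EReal) := by
      rw [hz]
      refine le_antisymm (sSup_le ?_) (le_of_forall_lt fun y hy => ?_)
      · rintro _ ⟨t, htS, rfl⟩
        exact EReal.coe_le_coe_iff.2 (hgt t htS)
      · obtain ⟨s, hys, hsT⟩ := EReal.lt_iff_exists_real_btwn.1 hy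
        have hm : max s (focusTime γ N C α / 2) < focusTime γ N C α :=
          max_lt (EReal.coe_lt_coe_iff.1 hsT) (by linarith)
        exact hys.trans_le ((EReal.coe_le_coe_iff.2 (le_max_left s _)).trans
          (coe_le_sSup_coe (hlt _ (lt_max_of_lt_right (by linarith)) hm)))
    refine ⟨⟨fun _ => ⟨hC, he⟩, fun _ => ⟨hz0, ?_⟩⟩, fun _ => hzT⟩
    rw [hzT]
    exact EReal.coe_lt_top _
  · -- the flux part has the smaller exponent: the defect is eventually positive at every time
    have htop : z = ⊤ := by
      rw [hz]
      refine sSup_coe_eq_top fun t ht => ⟨ht, ?_⟩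
      have hlim : Tendsto (fun w => defect f φ x₀ c t (c - σ * w) / w ^ (α + 2))
          (𝓝[>] 0) (𝓝 (C / (γ + 1) * (t * (N / (α + 1))) ^ (γ + 1) * 0 + t * (N / (α + 2)))) := by
        refine (((hparts t ht).1.mul (hrpow0 (γ * (1 + α) - 1) (by linarith))).add
          (hparts t ht).2).congr' ?_
        filter_upwards [self_mem_nhdsWithin, hpos (α + 2), hpos ((α + 1) * (γ + 1))]
          with w hw hw1 hw2
        rw [defect_eq_PhiLoc_add hφ, add_div]
        congr 1
        rw [hexp, Real.rpow_add hw]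
        have hw3 : w ^ (γ * (1 + α) - 1) ≠ 0 := (Real.rpow_pos_of_pos hw _).ne'
        field_simp
      rw [mul_zero, zero_add] at hlim
      have hp : 0 < t * (N / (α + 2)) := by positivity
      filter_upwards [hlim.eventually (lt_mem_nhds hp), hpos (α + 2)] with w hw hw1
      exact (div_pos_iff_of_pos_right hw1).1 hw
    exact ⟨⟨fun h => absurd h (hnotop htop), fun h => absurd h.2 he.ne'⟩,
      fun h => absurd h (hnotop htop)⟩

theorem tpPlus_of_powerLaws (hf : IsFlux f) (hφ : MemLp φ ⊤ volume)
    (hc : c ∈ charValues f φ x₀) (hflux : FluxPowerLaw f c (Iio c) α N)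
    (hdata : DataPowerLaw φ x₀ c (Ioi 0) γ C) :
    (tpPlus f φ x₀ c ∈ Ioo (0 : EReal) ⊤ ↔ C < 0 ∧ γ * (1 + α) = 1) ∧
      (tpPlus f φ x₀ c ∈ Ioo (0 : EReal) ⊤ →
        tpPlus f φ x₀ c = (focusTime γ N C α : EReal)) := by
  obtain ⟨hα, hN, hflux⟩ := hflux
  obtain ⟨hγ, hC, hdata⟩ := hdata
  have hmap : map (fun w => c - 1 * w) (𝓝[>] 0) = 𝓝[<] c := by
    simp
  refine sSup_of_powerLaws (x₀ := x₀) (c := c) (σ := 1) hf hφ (by norm_num) hα hN hγ hC ?_ ?_ ?_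
    ((tp_pos hf hφ hc).trans_le (min_le_left _ _))
  · rw [← hmap, tendsto_map'_iff] at hflux
    refine hflux.congr' ?_
    filter_upwards [self_mem_nhdsWithin] with w hw
    have : |c - 1 * w - c| = w := by
      rw [one_mul, sub_sub_cancel_left, abs_neg, abs_of_pos hw]
    simp only [Function.comp_apply, this]
  · refine hdata.congr' ?_
    filter_upwards [inf_le_left (a := 𝓝[>] (0 : ℝ)) self_mem_nhdsWithin] with l hl
    have hl' : (0 : ℝ) < l := hl
    rw [Real.sign_of_pos hl', abs_of_pos hl', one_mul, one_mul, one_mul, add_comm l]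
  · rw [tpPlus_eq hf hφ]
    congr 2
    ext t
    refine and_congr_right fun _ => ?_
    rw [← hmap, eventually_map]

theorem tpMinus_of_powerLaws (hf : IsFlux f) (hφ : MemLp φ ⊤ volume)
    (hc : c ∈ charValues f φ x₀) (hflux : FluxPowerLaw f c (Ioi c) α N)
    (hdata : DataPowerLaw φ x₀ c (Iio 0) γ C) :
    (tpMinus f φ x₀ c ∈ Ioo (0 : EReal) ⊤ ↔ C < 0 ∧ γ * (1 + α) = 1) ∧
      (tpMinus f φ x₀ c ∈ Ioo (0 : EReal) ⊤ →
        tpMinus f φ x₀ c = (focusTime γ N C α : EReal)) := by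
  obtain ⟨hα, hN, hflux⟩ := hflux
  obtain ⟨hγ, hC, hdata⟩ := hdata
  have hmap : map (fun w => c - -1 * w) (𝓝[>] 0) = 𝓝[>] c := by
    simp
  refine sSup_of_powerLaws (x₀ := x₀) (c := c) (σ := -1) hf hφ (by norm_num) hα hN hγ hC ?_ ?_ ?_
    ((tp_pos hf hφ hc).trans_le (min_le_right _ _))
  · rw [← hmap, tendsto_map'_iff] at hflux
    refine hflux.congr' ?_
    filter_upwards [self_mem_nhdsWithin] with w hw
    have : |c - -1 * w - c| = w := by
      rw [neg_one_mul, sub_neg_eq_add, add_sub_cancel_left, abs_of_pos hw]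
    simp only [Function.comp_apply, this]
  · have hneg : Tendsto (fun y : ℝ => -y) (𝓝[>] 0 ⊓ ae volume) (𝓝[<] 0 ⊓ ae volume) := by
      refine tendsto_inf.2 ⟨Tendsto.mono_left ?_ inf_le_left, Tendsto.mono_left ?_ inf_le_right⟩
      · simpa using tendsto_neg_nhdsGT (a := (0 : ℝ))
      · exact (Measure.measurePreserving_neg (volume : Measure ℝ)).quasiMeasurePreserving.tendsto_ae
    refine (hdata.comp hneg).congr' ?_
    filter_upwards [inf_le_left (a := 𝓝[>] (0 : ℝ)) self_mem_nhdsWithin] with y hy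
    have hy' : (0 : ℝ) < y := hy
    simp only [Function.comp_apply]
    rw [Real.sign_of_neg (neg_neg_of_pos hy'), abs_neg, abs_of_pos hy', neg_one_mul, neg_one_mul,
      neg_one_mul, div_neg, neg_div, add_comm x₀]
  · rw [tpMinus_eq hf hφ]
    congr 2
    ext t
    refine and_congr_right fun _ => ?_
    rw [← hmap, eventually_map]

end Side

end ConsLaw

end

open ConsLaw
theorem theorem4p1 (f φ : ℝ → ℝ) (hf : IsFlux f) (hφ : MemLp φ ⊤ volume) :
    -- every continuous shock generation point is the point `(x_p,t_p)` of some characteristic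
    (∀ x t : ℝ, IsContShockGenPoint f φ x t →
      ∃ x₀ : ℝ, ∃ c ∈ charValues f φ x₀,
        tp f φ x₀ c = (t : EReal) ∧ tStar f φ x₀ c = (t : EReal) ∧ x = x₀ + t * deriv f c) ∧
    -- criterion for the characteristic `L_c(x₀)` to end in a continuous shock generation point
    (∀ x₀ : ℝ, ∀ c ∈ charValues f φ x₀,
      ((tp f φ x₀ c ∈ Set.Ioo (0 : EReal) ⊤ ∧ tStar f φ x₀ c = tp f φ x₀ c ∧
          IsContShockGenPoint f φ (x₀ + (tp f φ x₀ c).toReal * deriv f c) (tp f φ x₀ c).toReal) ↔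
        (tp f φ x₀ c ∈ Set.Ioo (0 : EReal) ⊤ ∧
          StrictIneq f φ x₀ c (tp f φ x₀ c).toReal))) ∧
    -- case (i): only the two end points can have a finite `t_p`
    (∀ x₀ : ℝ, ∀ c ∈ charValues f φ x₀, upperLeftDini φ x₀ < lowerRightDini φ x₀ →
      tp f φ x₀ c ∈ Set.Ioo (0 : EReal) ⊤ →
        c = upperLeftDini φ x₀ ∨ c = lowerRightDini φ x₀) ∧
    -- case (i)(a)
    (∀ x₀ : ℝ, ∀ c ∈ charValues f φ x₀, upperLeftDini φ x₀ < lowerRightDini φ x₀ →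
      c = upperLeftDini φ x₀ →
      ∀ αp Np γm Cm : ℝ, FluxPowerLaw f c (Set.Ioi c) αp Np →
        DataPowerLaw φ x₀ c (Set.Iio 0) γm Cm →
        (tp f φ x₀ c ∈ Set.Ioo (0 : EReal) ⊤ ↔ Cm < 0 ∧ γm * (1 + αp) = 1) ∧
        (tp f φ x₀ c ∈ Set.Ioo (0 : EReal) ⊤ →
          tp f φ x₀ c = tpMinus f φ x₀ c ∧
          tpMinus f φ x₀ c = (focusTime γm Np Cm αp : EReal))) ∧
    -- case (i)(b)
    (∀ x₀ : ℝ, ∀ c ∈ charValues f φ x₀, upperLeftDini φ x₀ < lowerRightDini φ x₀ →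
      c = lowerRightDini φ x₀ →
      ∀ αm Nm γp Cp : ℝ, FluxPowerLaw f c (Set.Iio c) αm Nm →
        DataPowerLaw φ x₀ c (Set.Ioi 0) γp Cp →
        (tp f φ x₀ c ∈ Set.Ioo (0 : EReal) ⊤ ↔ Cp < 0 ∧ γp * (1 + αm) = 1) ∧
        (tp f φ x₀ c ∈ Set.Ioo (0 : EReal) ⊤ →
          tp f φ x₀ c = tpPlus f φ x₀ c ∧
          tpPlus f φ x₀ c = (focusTime γp Nm Cp αm : EReal))) ∧
    -- case (ii)
    (∀ x₀ : ℝ, ∀ c ∈ charValues f φ x₀, upperLeftDini φ x₀ = lowerRightDini φ x₀ →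
      ∀ αp Np αm Nm γp Cp γm Cm : ℝ,
        FluxPowerLaw f c (Set.Ioi c) αp Np → FluxPowerLaw f c (Set.Iio c) αm Nm →
        DataPowerLaw φ x₀ c (Set.Ioi 0) γp Cp → DataPowerLaw φ x₀ c (Set.Iio 0) γm Cm →
        (tpPlus f φ x₀ c ∈ Set.Ioo (0 : EReal) ⊤ ↔ Cp < 0 ∧ γp * (1 + αm) = 1) ∧
        (tpMinus f φ x₀ c ∈ Set.Ioo (0 : EReal) ⊤ ↔ Cm < 0 ∧ γm * (1 + αp) = 1) ∧
        (tpPlus f φ x₀ c ∈ Set.Ioo (0 : EReal) ⊤ →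
          tpPlus f φ x₀ c = (focusTime γp Nm Cp αm : EReal)) ∧
        (tpMinus f φ x₀ c ∈ Set.Ioo (0 : EReal) ⊤ →
          tpMinus f φ x₀ c = (focusTime γm Np Cm αp : EReal)) ∧
        (tp f φ x₀ c ∈ Set.Ioo (0 : EReal) ⊤ →
          (tpMinus f φ x₀ c ∈ Set.Ioo (0 : EReal) ⊤ ∧ tpPlus f φ x₀ c = ⊤ ∧
            tp f φ x₀ c = (focusTime γm Np Cm αp : EReal)) ∨
          (tpPlus f φ x₀ c ∈ Set.Ioo (0 : EReal) ⊤ ∧ tpMinus f φ x₀ c = ⊤ ∧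
            tp f φ x₀ c = (focusTime γp Nm Cp αm : EReal)) ∨
          (tpPlus f φ x₀ c ∈ Set.Ioo (0 : EReal) ⊤ ∧ tpMinus f φ x₀ c ∈ Set.Ioo (0 : EReal) ⊤ ∧
            tp f φ x₀ c =
              (min (focusTime γp Nm Cp αm) (focusTime γm Np Cm αp) : EReal)))) := by
  refine ⟨fun x t h => h.exists_characteristic hf hφ, fun x₀ c hc => ?_,
    fun x₀ c hc _ hT => ?_, fun x₀ c hc hlt hcU αp Np γm Cm hflux hdata => ?_,
    fun x₀ c hc hlt hcL αm Nm γp Cp hflux hdata => ?_,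
    fun x₀ c hc _ αp Np αm Nm γp Cp γm Cm hfluxp hfluxm hdatap hdatam => ?_⟩
  · refine and_congr_right fun hT => ?_
    obtain ⟨t, ht, hTt⟩ := exists_real_of_mem_Ioo hT
    rw [hTt, EReal.toReal_coe]
    exact contShockGenPoint_iff hf hφ hTt ht
  · by_contra! hne
    have h1 := tpPlus_eq_top hf hφ (lt_of_le_of_ne (le_lowerRightDini hf hφ hc) hne.2)
    have h2 := tpMinus_eq_top hf hφ (lt_of_le_of_ne (upperLeftDini_le hf hφ hc) hne.1.symm)
    rw [tp, h1, h2, min_self] at hT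
    exact hT.2.ne rfl
  · have htp : tp f φ x₀ c = tpMinus f φ x₀ c := by
      rw [tp, tpPlus_eq_top hf hφ (hcU.trans_lt hlt)]
      exact min_eq_right le_top
    have key := tpMinus_of_powerLaws hf hφ hc hflux hdata
    rw [htp]
    exact ⟨key.1, fun h => ⟨rfl, key.2 h⟩⟩
  · have htp : tp f φ x₀ c = tpPlus f φ x₀ c := by
      rw [tp, tpMinus_eq_top hf hφ (hlt.trans_eq hcL.symm)]
      exact min_eq_left le_top
    have key := tpPlus_of_powerLaws hf hφ hc hflux hdata
    rw [htp]
    exact ⟨key.1, fun h => ⟨rfl, key.2 h⟩⟩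
  · have kp := tpPlus_of_powerLaws hf hφ hc hfluxm hdatap
    have km := tpMinus_of_powerLaws hf hφ hc hfluxp hdatam
    have hp0 : 0 < tpPlus f φ x₀ c := (tp_pos hf hφ hc).trans_le (min_le_left _ _)
    have hm0 : 0 < tpMinus f φ x₀ c := (tp_pos hf hφ hc).trans_le (min_le_right _ _)
    refine ⟨kp.1, km.1, kp.2, km.2, fun hT => ?_⟩
    rcases eq_or_ne (tpPlus f φ x₀ c) ⊤ with hp | hp
    · rw [tp, hp, min_eq_right le_top] at hT ⊢
      exact Or.inl ⟨hT, rfl, km.2 hT⟩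
    rcases eq_or_ne (tpMinus f φ x₀ c) ⊤ with hm | hm
    · rw [tp, hm, min_eq_left le_top] at hT ⊢
      exact Or.inr (Or.inl ⟨hT, rfl, kp.2 hT⟩)
    · have hp' : tpPlus f φ x₀ c ∈ Set.Ioo (0 : EReal) ⊤ := ⟨hp0, lt_top_iff_ne_top.2 hp⟩
      have hm' : tpMinus f φ x₀ c ∈ Set.Ioo (0 : EReal) ⊤ := ⟨hm0, lt_top_iff_ne_top.2 hm⟩
      refine Or.inr (Or.inr ⟨hp', hm', ?_⟩)
      rw [tp, kp.2 hp', km.2 hm']
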